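/- **Setting.** Let $\Sigma$ and $\Gamma$ be finite alphabets. The convolution $\mathrm{conv}(x,y)$ of two words is the word of length $\max(|x|,|y|)$ obtained by padding the shorter word at its end with a blank symbol and combining the symbols at the same position into pairs. A family $\{L_e : e\in I\}$ of non-empty languages $L_e\subseteq\Sigma^*$ with $I\subseteq \Gamma^*$ is *automatic* if $I$ and $\{\mathrm{conv}(e,x): e\in I,\ x\in L_e\}$ are both regular. A *text* for $L$ is a sequence $w_0,w_1,\dots$ of words whose set of members is exactly $L$. A sequence of conjectures $e_0,e_1,\dots\in I$ *identifies* $L$ if there is $k$ with $L_{e_k}=L$ and $e_{k'}=e_k$ for all $k'\ge k$. The family is *learnable* if there are an initial memory (a word) and a computable mapping (old memory, new datum) $\mapsto$ (new memory, new conjecture), with no restriction on the length of the memory, whose conjectures identify every $L_e$, $e\in I$, on every text for $L_e$. A *learner with one additional queue* is a deterministic machine with finitely many states that has a one-sided infinite base tape, whose left end carries a fixed, unmodifiable marker, and one queue; all alphabets are finite. In one step the machine reads its state, the scanned symbol of the base tape and the symbol at the read-end of the queue (or the information that the queue is empty), and then changes its state, overwrites the scanned symbol, moves the head on the base tape by at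 most one cell, optionally removes the symbol at the read-end of the queue, and optionally appends one symbol at its write-end. It works in cycles. The queue is empty before the first cycle and keeps its content between cycles. In cycle $n$ the machine begins in its start state, with the head on the marker and with $\mathrm{conv}(w_n,m_n)$ on the base tape to the right of the marker, followed by blanks only, where $w_n$ is the current datum and $m_n$ the long-term memory ($m_0$ is fixed); when it halts, the word between the marker and the first blank is $\mathrm{conv}(m_{n+1},e_n)$, where $m_{n+1}$ is the new long-term memory and $e_n$ the hypothesis of this cycle. Such a learner is *linear-time* (with length-bounded base tape) if there is a constant $c$ such that on every sequence $w_0,w_1,\dots$ of words over $\Sigma$ and for every $n$, cycle $n$ halts after at most $c\cdot(|\mathrm{conv}(w_n,m_n)|+1)$ steps, and $|m_{n+1}|$, $|e_n|$ and every position of the base-tape head during the cycle (the marker being position $0$) are at most $\max_{i\le n}|w_i|+c$. **Theorem.** For every learnable automatic family $\{L_e:e\in I\}$ of non-empty languages there is a linear-time learner with one additional queue which learns it, i.e. for every $e\in I$ and every text for $L_e$, the hypotheses $e_0,e_1,\dots$ of the learner all belong to $I$ and identify $L_e$. -/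

import Mathlib

/-- The convolution of two words: the shorter word is padded at its end (with `none`), and the
symbols at the same position are combined into one symbol. -/
def conv {α β : Type} (x : List α) (y : List β) : List (Option α × Option β) :=
  List.zipWithAll Prod.mk x y

/-- `{L e : e ∈ I}` is an automatic family: the index set `I` and the set
`{conv(e, x) : e ∈ I, x ∈ L e}` are both regular. (The values of `L` off `I` do not matter.) -/
def IsAutomaticFamily {σ ι : Type} (I : Language ι) (L : List ι → Language σ) : Prop :=
  I.IsRegular ∧
    Language.IsRegular
      ({w | ∃ e ∈ I, ∃ x ∈ L e, w = conv e x} : Set (List (Option ι × Option σ)))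

/-- `T` is a text for the language `S`: it lists all elements of `S` and no non-element. -/
def IsText {σ : Type} (T : ℕ → List σ) (S : Language σ) : Prop :=
  ∀ w, (∃ n, T n = w) ↔ w ∈ S

/-- The sequence `hyp` of conjectures consists of indices in `I` and converges to an index of the
language `L e`. -/
def Identifies {σ ι : Type} (I : Language ι) (L : List ι → Language σ) (e : List ι)
    (hyp : ℕ → List ι) : Prop :=
  (∀ n, hyp n ∈ I) ∧ ∃ k, L (hyp k) = L e ∧ ∀ k', k ≤ k' → hyp k' = hyp k

/-- The memory before cycle `n` of a learner given as a mapping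
`(old memory, datum) ↦ (new memory, conjecture)`, on the data sequence `T`. -/
def memorySeq {μ σ ι : Type} (m₀ : μ) (M : μ → List σ → μ × List ι) (T : ℕ → List σ) : ℕ → μ
  | 0 => m₀
  | n + 1 => (M (memorySeq m₀ M T n) (T n)).1

/-- The conjecture made in cycle `n` by such a learner. -/
def conjectureSeq {μ σ ι : Type} (m₀ : μ) (M : μ → List σ → μ × List ι) (T : ℕ → List σ)
    (n : ℕ) : List ι :=
  (M (memorySeq m₀ M T n) (T n)).2

/-- The family `{L e : e ∈ I}` is learnable (in the limit, from text): some algorithmic mapping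
`(old memory, datum) ↦ (new memory, conjecture)`, with memory unrestricted in length, identifies
every language of the family from every text for it. -/
def Learnable {σ ι : Type} [Primcodable σ] [Primcodable ι] (I : Language ι)
    (L : List ι → Language σ) : Prop :=
  ∃ (m₀ : List Bool) (M : List Bool → List σ → List Bool × List ι), Computable₂ M ∧
    ∀ e ∈ I, ∀ T : ℕ → List σ, IsText T (L e) → Identifies I L e (conjectureSeq m₀ M T)

/-- Contents of a cell of the base tape to the right of the end marker: the blank symbol, a symbol
of a convolution of datum and memory, a symbol of a convolution of memory and hypothesis, or an
auxiliary symbol. -/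
inductive Cell (σ ι μ γ : Type) where
  | blank
  | input (a : Option σ × Option μ)
  | output (a : Option μ × Option ι)
  | work (g : γ)

/-- Head moves on the base tape. -/
inductive Move where
  | left
  | stay
  | right

/-- What the machine does in one step: next state, symbol written on the base tape, head move on
the base tape, whether the symbol at the read-end of the queue is removed, and which symbol, if
any, is appended at the write-end of the queue. -/
structure QueueAction (S C κ : Type) where
  next : S
  write : C
  move : Move
  pop : Bool
  push : Option κ

/-- A deterministic learning machine with a base tape and one additional queue. Data are words over
`σ`, hypotheses are words over `ι`. In the transition function, the second argument is the scanned
symbol of the base tape, with `none` for the marker at the left end, and the third argument is the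
symbol at the read-end of the queue, with `none` if the queue is empty. -/
structure QueueLearner (σ ι : Type) where
  /-- alphabet of the long term memory on the base tape -/
  Mem : Type
  /-- auxiliary symbols of the base tape -/
  Work : Type
  /-- alphabet of the queue -/
  Queue : Type
  State : Type
  finite_mem : Finite Mem
  finite_work : Finite Work
  finite_queue : Finite Queue
  finite_state : Finite State
  start : State
  halting : State → Bool
  /-- initial long term memory -/
  mem₀ : List Mem
  trans : State → Option (Cell σ ι Mem Work) → Option Queue →
    QueueAction State (Cell σ ι Mem Work) Queue

namespace QueueLearner

variable {σ ι : Type}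

/-- Configurations. Head position `0` is the left end marker, which occurs only there and cannot be
overwritten; head position `i + 1` is the cell `tape i`. The head of the list `queue` is the
read-end, its far end is the write-end. -/
structure Cfg (N : QueueLearner σ ι) where
  state : N.State
  head : ℕ
  tape : ℕ → Cell σ ι N.Mem N.Work
  queue : List N.Queue

/-- The scanned symbol of the base tape (`none` for the left end marker). -/
def Cfg.scanned {N : QueueLearner σ ι} (c : N.Cfg) : Option (Cell σ ι N.Mem N.Work) :=
  match c.head with
  | 0 => none
  | i + 1 => some (c.tape i)

/-- Writing at a head position; the left end marker is never changed. -/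
def writeAt {C : Type} (tape : ℕ → C) (head : ℕ) (a : C) : ℕ → C :=
  match head with
  | 0 => tape
  | i + 1 => Function.update tape i a

/-- Moving the head; a left move on the left end marker has no effect. -/
def moveHead (head : ℕ) : Move → ℕ
  | .left => head - 1
  | .stay => head
  | .right => head + 1

/-- One step of the machine; nothing happens any more in a halting state. -/
def step (N : QueueLearner σ ι) (c : N.Cfg) : N.Cfg :=
  if N.halting c.state then c
  else
    let a := N.trans c.state c.scanned c.queue.head?
    { state := a.next
      head := moveHead c.head a.move
      tape := writeAt c.tape c.head a.write
      queue := (if a.pop then c.queue.tail else c.queue) ++ a.push.toList }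

/-- The configuration at the beginning of a cycle: the base tape contains the convolution of the
current datum `v` and the old long term memory `m`, its head is on the left end marker, and the
queue is as the previous cycle left it. -/
def startCfg (N : QueueLearner σ ι) (m : List N.Mem) (q : List N.Queue) (v : List σ) : N.Cfg where
  state := N.start
  head := 0
  tape := fun i => ((conv v m)[i]?).elim Cell.blank Cell.input
  queue := q

/-- The word on the base tape between the left end marker and the first blank is the convolution of
the long term memory `m` and the hypothesis `h`. -/
def HoldsOutput {N : QueueLearner σ ι} (c : N.Cfg) (m : List N.Mem) (h : List ι) : Prop :=
  ∀ i, i ≤ (conv m h).length → c.tape i = ((conv m h)[i]?).elim Cell.blank Cell.output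

/-- On memory `m`, queue `q` and datum `v`, the cycle halts within `t` steps, and then memory,
queue and hypothesis are `m'`, `q'` and `h`. -/
def CycleWithin (N : QueueLearner σ ι) (t : ℕ) (m : List N.Mem) (q : List N.Queue) (v : List σ)
    (m' : List N.Mem) (q' : List N.Queue) (h : List ι) : Prop :=
  N.halting (N.step^[t] (N.startCfg m q v)).state = true ∧
    HoldsOutput (N.step^[t] (N.startCfg m q v)) m' h ∧
    (N.step^[t] (N.startCfg m q v)).queue = q'

/-- `mem n`, `queue n` are the memory and the queue before cycle `n`, and `hyp n` is the hypothesis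
output in cycle `n`, when the machine is fed with the data sequence `T`. -/
def IsRun (N : QueueLearner σ ι) (T : ℕ → List σ) (mem : ℕ → List N.Mem)
    (queue : ℕ → List N.Queue) (hyp : ℕ → List ι) : Prop :=
  mem 0 = N.mem₀ ∧ queue 0 = [] ∧
    ∀ n, ∃ t, N.CycleWithin t (mem n) (queue n) (T n) (mem (n + 1)) (queue (n + 1)) (hyp n)

/-- The length of the longest datum among `T 0, …, T n`. -/
def maxLen (T : ℕ → List σ) (n : ℕ) : ℕ :=
  (Finset.range (n + 1)).sup fun i => (T i).length

/-- The machine is a linear-time learner with length-bounded base tape: for some constant `c` and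
on every sequence of data, every cycle halts after a number of steps that is at most `c` times (one
plus) the length of the base tape at its beginning, and neither the new memory nor the hypothesis
nor the part of the base tape used during the cycle exceeds the length of the longest datum seen so
far by more than `c`. As a step moves at most one symbol into and one symbol out of the queue, the
traffic on the queue is subject to the same linear bound. -/
def IsLinearTime (N : QueueLearner σ ι) : Prop :=
  ∃ c : ℕ, ∀ T : ℕ → List σ, ∃ mem queue hyp, N.IsRun T mem queue hyp ∧
    ∀ n,
      (∃ t, t ≤ c * ((conv (T n) (mem n)).length + 1) ∧
        N.CycleWithin t (mem n) (queue n) (T n) (mem (n + 1)) (queue (n + 1)) (hyp n)) ∧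
      (mem (n + 1)).length ≤ maxLen T n + c ∧
      (hyp n).length ≤ maxLen T n + c ∧
      ∀ s, (N.step^[s] (N.startCfg (mem n) (queue n) (T n))).head ≤ maxLen T n + c

/-- The machine learns the family `{L e : e ∈ I}`: on every text for a language of the family its
hypotheses are indices that converge to an index of this language. -/
def Learns (N : QueueLearner σ ι) (I : Language ι) (L : List ι → Language σ) : Prop :=
  ∀ e ∈ I, ∀ T : ℕ → List σ, IsText T (L e) →
    ∃ mem queue hyp, N.IsRun T mem queue hyp ∧ Identifies I L e hyp

end QueueLearner

/-! Learnability enters only through Angluin's condition. A learner that identifies `L e` from every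
text has a locking sequence, and the words of that sequence form a finite tell-tale set: no language
of the family contains the set and lies properly inside `L e` (`exists_telltale`). Automaticity
makes this effective. Only finitely many behaviours of the automata have to be distinguished after
reading a prefix of length `|e|`, so for a uniform `c` the words of `L e` of length at most `|e| +
c` are a tell-tale set (`exists_telltale_bound`). For the same reason a language with words of
length at most `m` has an index of length at most `m + c` (`exists_index_bound`). Hence some correct
index eventually fits into the memory.

The learner keeps all data in the queue. A cycle appends the new datum and moves the front record to
the back. Before cycle `n` there are `n` records, so the cycles `2 ^ r, …, 2 ^ (r + 1) - 1` form a
round in which exactly the first `2 ^ r` data are reread. The very first datum is marked and is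
always the last record of a round, so the end of a round is recognised without counting. The memory
holds a candidate `e` and a test word `x`, both fixed during a round. The candidate is rejected if
it is ill-formed or too long, if some record is outside `L e`, or if `x` is in the tell-tale set of
`e` but is not among the records. The test word advances in every round, the candidate only after a
rejection.

Both are odometers whose digits carry a spare bit. They reach every word that fits, whether the tape
stops growing (and they overflow) or not (`Odometer.exists_spells`). A candidate that is never
rejected is correct: its language contains all data, and each of its tell-tale words is eventually
tested and found (`eq_of_forall_rej_eq_false`). A correct candidate that fits is no longer rejected
once its tell-tale words have appeared (`rej_eq_false`), so rejections cannot go on forever.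

All checks and increments of a cycle are done by a finite automaton in one sweep over the tape, with
the verdict distributed on the way back (`cycle_spec`, `program_cycle`). -/

/-! ### Convolutions. -/

section Conv

variable {α β : Type}

theorem conv_getElem? (x : List α) (y : List β) (i : ℕ) :
    (conv x y)[i]? = match x[i]?, y[i]? with
      | none, none => none
      | a, b => some (a, b) := by
  unfold conv
  rw [List.getElem?_zipWithAll]
  cases x[i]? <;> cases y[i]? <;> rfl

@[simp] theorem conv_nil_nil : conv ([] : List α) ([] : List β) = [] := rfl

theorem conv_length (x : List α) (y : List β) :
    (conv x y).length = max x.length y.length := by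
  induction x generalizing y with
  | nil => simp [conv]
  | cons a x ih =>
    cases y with
    | nil => simp [conv]
    | cons b y => simpa [conv] using ih y

theorem conv_take_drop (n : ℕ) (x : List α) (y : List β) :
    conv (x.take n) (y.take n) ++ conv (x.drop n) (y.drop n) = conv x y := by
  induction n generalizing x y with
  | zero => simp
  | succ n ih =>
    cases x with
    | nil =>
      cases y with
      | nil => rfl
      | cons b y => simp [conv]
    | cons a x =>
      cases y with
      | nil => simp [conv]
      | cons b y => simpa [conv] using ih x y

theorem conv_injective {x x' : List α} {y y' : List β} (h : conv x y = conv x' y') :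
    x = x' ∧ y = y' := by
  have key : ∀ i : ℕ, x[i]? = x'[i]? ∧ y[i]? = y'[i]? := by
    intro i
    have := congrArg (fun l => l[i]?) h
    simp only [conv_getElem?] at this
    revert this
    cases x[i]? <;> cases y[i]? <;> cases x'[i]? <;> cases y'[i]? <;> simp
  exact ⟨List.ext_getElem? fun i => (key i).1, List.ext_getElem? fun i => (key i).2⟩

end Conv

/-! ### Locking sequences and tell-tale sets. -/

theorem memorySeq_eq_foldl {μ σ ι : Type} (m₀ : μ) (M : μ → List σ → μ × List ι)
    (T : ℕ → List σ) (n : ℕ) :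
    memorySeq m₀ M T n = ((List.range n).map T).foldl (fun m w => (M m w).1) m₀ := by
  induction n with
  | zero => rfl
  | succ n ih => simp [memorySeq, ih, List.range_succ]

theorem exists_seq_of_prefix {α : Type} (s : ℕ → List α) (hs : ∀ n, s n <+: s (n + 1))
    (hl : ∀ n, n ≤ (s n).length) :
    ∃ T : ℕ → α, ∀ n, s n = (List.range (s n).length).map T := by
  have mono : ∀ m n, m ≤ n → s m <+: s n := by
    intro m n h
    induction h with
    | refl => exact List.prefix_rfl
    | step _ ih => exact ih.trans (hs _)
  refine ⟨fun i => (s (i + 1))[i]'(hl (i + 1)), fun n => ?_⟩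
  apply List.ext_getElem
  · simp
  · intro i h1 h2
    simp only [List.getElem_map, List.getElem_range]
    rcases le_total n (i + 1) with h | h
    · exact (mono _ _ h).getElem h1
    · exact ((mono _ _ h).getElem (hl (i + 1))).symm

section Angluin

variable {μ σ ι : Type} {I : Language ι} {L : List ι → Language σ}

/-- A learner that identifies `L e` from every text has a locking sequence for `L e`. -/
theorem exists_locking_sequence [Countable σ] (m₀ : μ) (M : μ → List σ → μ × List ι)
    {e : List ι} (hne : ∃ x, x ∈ L e)
    (hM : ∀ T : ℕ → List σ, IsText T (L e) → Identifies I L e (conjectureSeq m₀ M T)) :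
    ∃ (τ : List (List σ)) (h : List ι), (∀ x ∈ τ, x ∈ L e) ∧ L h = L e ∧
      ∀ τ' : List (List σ), (∀ x ∈ τ', x ∈ L e) → ∀ w ∈ L e,
        (M ((τ ++ τ').foldl (fun m w => (M m w).1) m₀) w).2 = h := by
  by_contra! hcon
  obtain ⟨x₀, hx₀⟩ := hne
  have : Nonempty {x // x ∈ L e} := ⟨⟨x₀, hx₀⟩⟩
  obtain ⟨f, hf⟩ := exists_surjective_nat {x // x ∈ L e}
  -- Stage `n` of an adversarial text: `δ` presents the `n`-th word of `L e`, so that the limit is a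
  -- text, and whenever the conjecture on it is correct, `δ` goes on until the conjecture changes.
  have hstep : ∀ (n : ℕ) (τ : List (List σ)), ∃ δ : List (List σ), (∀ x ∈ τ, x ∈ L e) →
      (∀ x ∈ δ, x ∈ L e) ∧ (δ.head? = some (f n).1) ∧
      (L (M (τ.foldl (fun m w => (M m w).1) m₀) (f n).1).2 = L e →
        ∃ τ' w, δ = (f n).1 :: τ' ++ [w] ∧
          (M ((τ ++ (f n).1 :: τ').foldl (fun m w => (M m w).1) m₀) w).2 ≠
            (M (τ.foldl (fun m w => (M m w).1) m₀) (f n).1).2) := by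
    intro n τ
    by_cases hτ : ∀ x ∈ τ, x ∈ L e
    · by_cases hL : L (M (τ.foldl (fun m w => (M m w).1) m₀) (f n).1).2 = L e
      · obtain ⟨τ', hτ', w, hw, hne⟩ := hcon (τ ++ [(f n).1]) _ (by
          intro x hx
          rcases List.mem_append.1 hx with h | h
          · exact hτ x h
          · rw [List.mem_singleton.1 h]; exact (f n).2) hL
        refine ⟨(f n).1 :: τ' ++ [w], fun _ => ⟨?_, by simp, fun _ => ⟨τ', w, rfl, ?_⟩⟩⟩
        · intro x hx
          simp only [List.cons_append, List.mem_cons, List.mem_append, List.not_mem_nil,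
            or_false] at hx
          rcases hx with h | h | h
          · rw [h]; exact (f n).2
          · exact hτ' x h
          · rw [h]; exact hw
        · simpa using hne
      · refine ⟨[(f n).1], fun _ => ⟨?_, rfl, fun h => absurd h hL⟩⟩
        intro x hx
        rw [List.mem_singleton.1 hx]
        exact (f n).2
    · exact ⟨[], fun h => absurd h hτ⟩
  choose δ hδ using hstep
  let s : ℕ → List (List σ) := fun n => n.rec [] fun n τ => τ ++ δ n τ
  have hs : ∀ n, s (n + 1) = s n ++ δ n (s n) := fun n => rfl
  have hsL : ∀ n, ∀ x ∈ s n, x ∈ L e := by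
    intro n
    induction n with
    | zero => intro x hx; exact absurd hx List.not_mem_nil
    | succ n ih =>
      intro x hx
      rw [hs] at hx
      rcases List.mem_append.1 hx with h | h
      · exact ih x h
      · exact (hδ n (s n) ih).1 x h
  have hpos : ∀ n, 1 ≤ (δ n (s n)).length := by
    intro n
    have := (hδ n (s n) (hsL n)).2.1
    cases h : δ n (s n) with
    | nil => simp [h] at this
    | cons _ _ => simp
  have hlen : ∀ n, n ≤ (s n).length := by
    intro n
    induction n with
    | zero => simp
    | succ n ih => rw [hs, List.length_append]; have := hpos n; omega
  obtain ⟨T, hT⟩ := exists_seq_of_prefix s (fun n => ⟨_, (hs n).symm⟩) hlen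
  have hTget : ∀ n i, i < (s n).length → (s n)[i]? = some (T i) := by
    intro n i hi
    conv_lhs => rw [hT n]
    simp [hi]
  have htext : IsText T (L e) := by
    intro w
    constructor
    · rintro ⟨n, rfl⟩
      exact hsL (n + 1) _ (List.mem_of_getElem? (hTget (n + 1) n (hlen (n + 1))))
    · intro hw
      obtain ⟨n, hn⟩ := hf ⟨w, hw⟩
      have h1 := (hδ n (s n) (hsL n)).2.1
      refine ⟨(s n).length, ?_⟩
      have h2 := hTget (n + 1) (s n).length (by
        rw [hs, List.length_append]; have := hpos n; omega)
      rw [hs, List.getElem?_append_right le_rfl, Nat.sub_self, ← List.head?_eq_getElem?, h1] at h2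
      rw [← Option.some.inj h2, hn]
  have hconj : ∀ (τ : List (List σ)) (w : List σ) (n : ℕ), τ ++ [w] <+: s n →
      (M (τ.foldl (fun m w => (M m w).1) m₀) w).2 = conjectureSeq m₀ M T τ.length := by
    rintro τ w n ⟨r, hr⟩
    have h0 : τ.length < (s n).length := by rw [← hr]; simp
    have h1 : τ = (List.range τ.length).map T := by
      apply List.ext_getElem?
      intro i
      by_cases hi : i < τ.length
      · have h2 := hTget n i (hi.trans h0)
        rw [← hr, List.append_assoc, List.getElem?_append_left hi] at h2
        rw [h2]
        simp [hi]
      · rw [List.getElem?_eq_none (by omega), List.getElem?_eq_none (by simp; omega)]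
    have h2 := hTget n τ.length h0
    rw [← hr, List.append_assoc, List.getElem?_append_right le_rfl] at h2
    simp only [Nat.sub_self, List.cons_append, List.getElem?_cons_zero, Option.some.injEq] at h2
    rw [conjectureSeq, memorySeq_eq_foldl, ← h1, h2]
  obtain ⟨-, k, hk, hk'⟩ := hM T htext
  have hcur : (M ((s k).foldl (fun m w => (M m w).1) m₀) (f k).1).2 =
      conjectureSeq m₀ M T (s k).length := by
    refine hconj _ _ (k + 1) ?_
    have h1 := (hδ k (s k) (hsL k)).2.1
    rw [hs]
    cases h : δ k (s k) with
    | nil => simp [h] at h1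
    | cons a t =>
      simp only [h, List.head?_cons, Option.some.injEq] at h1
      exact ⟨t, by simp [h1]⟩
  -- Stage `k` begins at position at least `k`, after convergence to a correct index; but then that
  -- stage was built to contain a change of the conjecture.
  have hkk := hk' _ (hlen k)
  obtain ⟨τ', w, hd, hneq⟩ := (hδ k (s k) (hsL k)).2.2 (by rw [hcur, hkk, hk])
  apply hneq
  have h2 := hconj (s k ++ (f k).1 :: τ') w (k + 1) (by rw [hs, hd]; simp)
  rw [h2, hcur, hkk, hk']
  have := hlen k
  simp
  omega

/-- Angluin's condition: every language of a learnable family has a finite tell-tale set. -/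
theorem exists_telltale [Countable σ] (m₀ : μ) (M : μ → List σ → μ × List ι)
    (hne : ∀ e ∈ I, ∃ x, x ∈ L e)
    (hM : ∀ e ∈ I, ∀ T : ℕ → List σ, IsText T (L e) → Identifies I L e (conjectureSeq m₀ M T))
    {e : List ι} (he : e ∈ I) :
    ∃ N : ℕ, ∀ d ∈ I, (∀ x ∈ L e, x.length ≤ N → x ∈ L d) → (∀ x ∈ L d, x ∈ L e) →
      L d = L e := by
  obtain ⟨τ, h, hτ, hh, hlock⟩ := exists_locking_sequence m₀ M (hne e he) (hM e he)
  -- Any upper bound for the lengths of the words in `τ` would do.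
  refine ⟨(τ.map List.length).sum, fun d hd h1 h2 => ?_⟩
  obtain ⟨x₀, hx₀⟩ := hne d hd
  have : Nonempty {x // x ∈ L d} := ⟨⟨x₀, hx₀⟩⟩
  obtain ⟨f, hf⟩ := exists_surjective_nat {x // x ∈ L d}
  have hτd : ∀ x ∈ τ, x ∈ L d := fun x hx =>
    h1 x (hτ x hx) (List.le_sum_of_mem (List.mem_map_of_mem hx))
  -- A text for `L d` that starts with `τ`. As `L d ⊆ L e`, the learner stays locked on `h`, which
  -- must therefore be an index of `L d` as well.
  let T : ℕ → List σ := fun n => (τ[n]?).getD (f (n - τ.length)).1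
  have hTmem : ∀ n, T n ∈ L d := by
    intro n
    by_cases hn : n < τ.length
    · simpa [T, hn] using hτd _ (List.getElem_mem hn)
    · simpa [T, hn] using (f (n - τ.length)).2
  have htext : IsText T (L d) := by
    intro w
    constructor
    · rintro ⟨n, rfl⟩
      exact hTmem n
    · intro hw
      obtain ⟨n, hn⟩ := hf ⟨w, hw⟩
      exact ⟨τ.length + n, by simp [T, hn]⟩
  obtain ⟨-, k, hk, hk'⟩ := hM d hd T htext
  have hval : conjectureSeq m₀ M T (τ.length + k) = h := by
    rw [conjectureSeq, memorySeq_eq_foldl]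
    have : (List.range (τ.length + k)).map T =
        τ ++ (List.range k).map fun i => T (τ.length + i) := by
      rw [List.range_add, List.map_append, List.map_map]
      congr 1
      apply List.ext_getElem
      · simp
      · intro i _ hi
        simp [T, hi]
    rw [this]
    refine hlock _ ?_ _ (h2 _ (hTmem _))
    intro x hx
    obtain ⟨i, -, rfl⟩ := List.mem_map.1 hx
    exact h2 _ (hTmem _)
  rw [← hk, ← hk' _ (Nat.le_add_left _ _), hval, hh]

end Angluin

/-! ### Uniform bounds from finite automata. -/

section Automata

/-- Each decreasing predicate either holds everywhere or fails from some point on; finitely many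
such points have a common bound. -/
theorem exists_uniform_threshold {K : Type} [Finite K] (P : K → ℕ → Prop)
    (hP : ∀ k r r', r ≤ r' → P k r' → P k r) : ∃ c, ∀ k, P k c → ∀ r, P k r := by
  have h : ∀ k, ∃ c, P k c → ∀ r, P k r := by
    intro k
    by_cases h : ∀ r, P k r
    · exact ⟨0, fun _ => h⟩
    · push Not at h
      obtain ⟨r, hr⟩ := h
      exact ⟨r, fun h => absurd h hr⟩
  choose c hc using h
  obtain ⟨b, hb⟩ := (Set.finite_range c).bddAbove
  exact ⟨b, fun k hk => hc k (hP k _ _ (hb ⟨k, rfl⟩) hk)⟩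

variable {σ ι Q P : Type} {I : Language ι} {L : List ι → Language σ}

theorem eval_conv_split (A : DFA (Option ι × Option σ) Q) (n : ℕ) (e : List ι) (x : List σ) :
    A.eval (conv e x) =
      A.evalFrom (A.eval (conv (e.take n) (x.take n))) (conv (e.drop n) (x.drop n)) := by
  rw [← conv_take_drop n e x]
  exact DFA.evalFrom_of_append ..

/-- In an automatic family whose languages have finite tell-tale sets, the words of `L e` that
exceed `e` in length by at most a constant form a tell-tale set. -/
theorem exists_telltale_bound [Finite Q] [Finite P] (A : DFA (Option ι × Option σ) Q)
    (B : DFA ι P) (hA : ∀ e ∈ I, ∀ x, A.eval (conv e x) ∈ A.accept ↔ x ∈ L e)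
    (hB : ∀ e, B.eval e ∈ B.accept ↔ e ∈ I)
    (htell : ∀ e ∈ I, ∃ N : ℕ, ∀ d ∈ I, (∀ x ∈ L e, x.length ≤ N → x ∈ L d) →
      (∀ x ∈ L d, x ∈ L e) → L d = L e) :
    ∃ c : ℕ, ∀ e ∈ I, ∀ d ∈ I, (∀ x ∈ L e, x.length ≤ e.length + c → x ∈ L d) →
      (∀ x ∈ L d, x ∈ L e) → L d = L e := by
  let Acc : Q → List ι → List σ → Prop := fun s d z => A.evalFrom s (conv d z) ∈ A.accept
  let Φ : Set (Q × Q × Bool) × P × Bool → ℕ → Prop := fun k r =>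
    ∃ d₂ : List ι, B.evalFrom k.2.1 d₂ ∈ B.accept ∧ (k.2.2 = true → d₂ = []) ∧
      (∀ u ∈ k.1, ∀ z : List σ, (u.2.2 = true → z = []) →
        (Acc u.2.1 d₂ z → Acc u.1 [] z) ∧ (z.length ≤ r → Acc u.1 [] z → Acc u.2.1 d₂ z)) ∧
      ∃ u ∈ k.1, ∃ z : List σ, (u.2.2 = true → z = []) ∧ Acc u.1 [] z ∧ ¬ Acc u.2.1 d₂ z
  obtain ⟨c, hc⟩ := exists_uniform_threshold Φ (by
    rintro k r r' hr ⟨d₂, h1, h2, h3, h4⟩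
    exact ⟨d₂, h1, h2, fun u hu z hz => ⟨(h3 u hu z hz).1,
      fun h => (h3 u hu z hz).2 (h.trans hr)⟩, h4⟩)
  refine ⟨c, fun e he d hd h1 h2 => ?_⟩
  by_contra hneq
  have hsub : ∃ x ∈ L e, x ∉ L d := by
    by_contra! h
    exact hneq (Set.Subset.antisymm h2 h)
  let U : Set (Q × Q × Bool) := {u | ∃ x : List σ, x.length ≤ e.length ∧
    (u.2.2 = true ↔ x.length < e.length) ∧ u.1 = A.eval (conv e x) ∧
    u.2.1 = A.eval (conv (d.take e.length) x)}
  let k : Set (Q × Q × Bool) × P × Bool :=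
    (U, B.eval (d.take e.length), decide (d.length < e.length))
  have hsplit_e : ∀ x : List σ, A.eval (conv e x) =
      A.evalFrom (A.eval (conv e (x.take e.length))) (conv [] (x.drop e.length)) := by
    intro x
    simpa using eval_conv_split A e.length e x
  have hsplit_d : ∀ d₂ : List ι, (d.length < e.length → d₂ = []) → ∀ x : List σ,
      A.eval (conv (d.take e.length ++ d₂) x) =
      A.evalFrom (A.eval (conv (d.take e.length) (x.take e.length)))
        (conv d₂ (x.drop e.length)) := by
    intro d₂ hd₂ x
    have h := eval_conv_split A e.length (d.take e.length ++ d₂) x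
    by_cases hlt : d.length < e.length
    · obtain rfl := hd₂ hlt
      have h3 : (d.take e.length ++ []).drop e.length = [] := by
        apply List.drop_eq_nil_of_le
        simp
      rw [h3] at h
      simpa only [List.append_nil, List.take_take, min_self, List.drop_nil] using h
    · have h3 : (d.take e.length).length = e.length := by simp; omega
      rw [List.take_left' h3, List.drop_left' h3] at h
      exact h
  have hmemB : ∀ d₂, B.evalFrom (B.eval (d.take e.length)) d₂ ∈ B.accept ↔
      d.take e.length ++ d₂ ∈ I := by
    intro d₂
    rw [← hB]
    simp only [DFA.eval, DFA.evalFrom_of_append]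
  have hu : ∀ x : List σ, (A.eval (conv e (x.take e.length)),
      A.eval (conv (d.take e.length) (x.take e.length)),
      decide (x.length < e.length)) ∈ U := by
    intro x
    exact ⟨x.take e.length, by simp, by simp, rfl, rfl⟩
  have hdrop : ∀ x : List σ, decide (x.length < e.length) = true → x.drop e.length = [] := by
    intro x hx
    exact List.drop_eq_nil_of_le (of_decide_eq_true hx).le
  -- Conversely, each triple in `U` with an admissible `z` comes from an actual word, so statements
  -- about states and tails are statements about membership.
  have hjoin : ∀ u ∈ U, ∀ z : List σ, (u.2.2 = true → z = []) →
      ∃ x : List σ, x.take e.length ++ z = x ∧ x.drop e.length = z ∧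
        x.length ≤ e.length + z.length ∧
        u.1 = A.eval (conv e (x.take e.length)) ∧
        u.2.1 = A.eval (conv (d.take e.length) (x.take e.length)) := by
    rintro u ⟨x, hx1, hx2, hx3, hx4⟩ z hz
    rcases hx1.lt_or_eq with hlt | heq
    · obtain rfl := hz (hx2.2 hlt)
      have : x.take e.length = x := List.take_of_length_le hx1
      exact ⟨x, by simp [this], List.drop_eq_nil_of_le hx1, by simpa using hx1,
        by rw [this, hx3], by rw [this, hx4]⟩
    · refine ⟨x ++ z, ?_, ?_, by simp [heq], ?_, ?_⟩
      · rw [List.take_left' heq]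
      · rw [List.drop_left' heq]
      · rw [List.take_left' heq, hx3]
      · rw [List.take_left' heq, hx4]
  have hd₂ : d.length < e.length → d.drop e.length = [] := fun h =>
    List.drop_eq_nil_of_le h.le
  have hΦ : Φ k c := by
    refine ⟨d.drop e.length, ?_, fun h => hd₂ (of_decide_eq_true h), ?_, ?_⟩
    · rw [hmemB]; simpa using hd
    · intro u hu z hz
      obtain ⟨x, -, hx2, hx3, hx4, hx5⟩ := hjoin u hu z hz
      have e1 : Acc u.2.1 (d.drop e.length) z ↔ x ∈ L d := by
        rw [← hA d hd]
        simp only [Acc]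
        rw [hx5, ← hx2, ← hsplit_d _ hd₂, List.take_append_drop]
      have e2 : Acc u.1 [] z ↔ x ∈ L e := by
        rw [← hA e he]
        simp only [Acc]
        rw [hx4, ← hx2, ← hsplit_e]
      rw [e1, e2]
      exact ⟨h2 x, fun hr hx => h1 x hx (by omega)⟩
    · obtain ⟨x, hx1, hx2⟩ := hsub
      refine ⟨_, hu x, x.drop e.length, hdrop x, ?_, ?_⟩
      · simp only [Acc]; rwa [← hsplit_e, hA e he]
      · simp only [Acc]; rwa [← hsplit_d _ hd₂, List.take_append_drop, hA d hd]
  -- By the choice of `c`, the counterexample `d` yields one that agrees with `L e` up to length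
  -- `|e| + N`, where `N` bounds a genuine tell-tale set of `L e`.
  obtain ⟨N, hN⟩ := htell e he
  obtain ⟨d₂, g1, g2, g3, g4⟩ := hc k hΦ N
  have hd' : d.take e.length ++ d₂ ∈ I := (hmemB d₂).1 g1
  have g2' : d.length < e.length → d₂ = [] := fun h => g2 (decide_eq_true h)
  have hfin := hN _ hd' (by
      intro x hx hxl
      have := (g3 _ (hu x) (x.drop e.length) (hdrop x)).2 (by simp; omega)
      simp only [Acc] at this
      rw [← hsplit_e, ← hsplit_d _ g2', hA e he, hA _ hd'] at this
      exact this hx) (by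
      intro x hx
      have := (g3 _ (hu x) (x.drop e.length) (hdrop x)).1
      simp only [Acc] at this
      rw [← hsplit_e, ← hsplit_d _ g2', hA e he, hA _ hd'] at this
      exact this hx)
  obtain ⟨u, hu, z, hz, hz1, hz2⟩ := g4
  obtain ⟨x, -, hx2, -, hx4, hx5⟩ := hjoin u hu z hz
  simp only [Acc] at hz1 hz2
  rw [hx4, ← hx2, ← hsplit_e, hA e he] at hz1
  rw [hx5, ← hx2, ← hsplit_d _ g2', hA _ hd', hfin] at hz2
  exact hz2 hz1

/-- A language of an automatic family all whose words have length at most `m` has an index of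
length at most `m` plus a constant. -/
theorem exists_index_bound [Finite Q] [Finite P] (A : DFA (Option ι × Option σ) Q)
    (B : DFA ι P) (hA : ∀ e ∈ I, ∀ x, A.eval (conv e x) ∈ A.accept ↔ x ∈ L e)
    (hB : ∀ e, B.eval e ∈ B.accept ↔ e ∈ I) :
    ∃ c : ℕ, ∀ e ∈ I, ∀ m : ℕ, (∀ x ∈ L e, x.length ≤ m) →
      ∃ e' ∈ I, L e' = L e ∧ e'.length ≤ m + c := by
  let Acc : Q → List ι → List σ → Prop := fun s d z => A.evalFrom s (conv d z) ∈ A.accept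
  -- All that matters about the part of the index behind position `m`: membership in `I`, acceptance
  -- of words that end by then, and whether any longer word is accepted. There are finitely many
  -- values, so the tail can be replaced by one of finitely many representatives.
  let F : List ι → Set P × Set Q × Set Q := fun d =>
    ({p | B.evalFrom p d ∈ B.accept}, {s | Acc s d []}, {s | ∃ z, z ≠ [] ∧ Acc s d z})
  have hw : ∃ g : Set P × Set Q × Set Q → List ι, ∀ d, F (g (F d)) = F d := by
    classical
    refine ⟨fun k => if h : ∃ d, F d = k then h.choose else [], fun d => ?_⟩
    have h : ∃ d', F d' = F d := ⟨d, rfl⟩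
    beta_reduce
    rw [dif_pos h]
    exact h.choose_spec
  obtain ⟨g, hg⟩ := hw
  obtain ⟨c, hc⟩ := (Set.finite_range fun k => (g k).length).bddAbove
  refine ⟨c, fun e he m hm => ?_⟩
  by_cases hlen : e.length ≤ m
  · exact ⟨e, he, rfl, by omega⟩
  have htake : (e.take m).length = m := by simp; omega
  set e₂ := g (F (e.drop m)) with he₂
  have hF : F e₂ = F (e.drop m) := hg _
  have hF1 := congrArg (fun t => t.1) hF
  have hF2 := congrArg (fun t => t.2.1) hF
  have hF3 := congrArg (fun t => t.2.2) hF
  simp only [F] at hF1 hF2 hF3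
  have he' : e.take m ++ e₂ ∈ I := by
    have h1 : B.eval (e.take m) ∈ {p | B.evalFrom p e₂ ∈ B.accept} := by
      rw [hF1]
      simp only [Set.mem_ofPred_eq]
      rwa [DFA.eval, ← DFA.evalFrom_of_append, List.take_append_drop, ← DFA.eval, hB]
    rw [← hB, DFA.eval, DFA.evalFrom_of_append]
    exact h1
  have hmem : ∀ x, x ∈ L e ↔
      A.eval (conv (e.take m) (x.take m)) ∈ {s | Acc s (e.drop m) (x.drop m)} := by
    intro x
    rw [← hA e he, eval_conv_split A m]
    rfl
  have hmem' : ∀ x, x ∈ L (e.take m ++ e₂) ↔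
      A.eval (conv (e.take m) (x.take m)) ∈ {s | Acc s e₂ (x.drop m)} := by
    intro x
    rw [← hA _ he', eval_conv_split A m, List.take_left' htake, List.drop_left' htake]
    rfl
  refine ⟨_, he', ?_, ?_⟩
  · ext x
    rw [hmem, hmem']
    by_cases hx : x.drop m = []
    · rw [hx, hF2]
    · constructor
      · intro h
        -- A word longer than `m` accepted with the new tail would give one accepted with the old
        -- tail, though perhaps a different one; this already contradicts `hm`.
        have h1 : A.eval (conv (e.take m) (x.take m)) ∈ {s | ∃ z, z ≠ [] ∧ Acc s e₂ z} :=
          ⟨_, hx, h⟩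
        rw [hF3] at h1
        obtain ⟨z, hz, hzA⟩ := h1
        have hxm : m < x.length := by
          by_contra hcon
          exact hx (List.drop_eq_nil_of_le (by omega))
        have htx : (x.take m).length = m := by simp; omega
        have h2 : x.take m ++ z ∈ L e := by
          rw [hmem, List.take_left' htx, List.drop_left' htx]
          exact hzA
        have h3 := hm _ h2
        have : z.length = 0 := by rw [List.length_append] at h3; omega
        exact absurd (List.length_eq_zero_iff.1 this) hz
      · intro h
        have h1 := hm x ((hmem x).2 h)
        exact absurd (List.drop_eq_nil_of_le h1) hx
  · rw [List.length_append, htake]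
    exact Nat.add_le_add_left (hc ⟨_, rfl⟩) m

end Automata

/-! ### Runs with bounded head position. -/

namespace QueueLearner

variable {σ ι : Type}

/-- From `c`, the machine reaches `c'` in `n` steps, and its head stays within the first `B`
cells. -/
def Reaches (N : QueueLearner σ ι) (B n : ℕ) (c c' : N.Cfg) : Prop :=
  N.step^[n] c = c' ∧ ∀ s ≤ n, (N.step^[s] c).head ≤ B

variable {N : QueueLearner σ ι} {B n n' : ℕ} {c c' c'' : N.Cfg}

theorem Reaches.refl (h : c.head ≤ B) : N.Reaches B 0 c c :=
  ⟨rfl, fun s hs => by rw [Nat.le_zero.1 hs]; exact h⟩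

theorem Reaches.trans (h : N.Reaches B n c c') (h' : N.Reaches B n' c' c'') :
    N.Reaches B (n + n') c c'' := by
  obtain ⟨rfl, h2⟩ := h
  obtain ⟨h3, h4⟩ := h'
  refine ⟨by rw [Nat.add_comm, Function.iterate_add_apply, h3], fun s hs => ?_⟩
  rcases le_total s n with h | h
  · exact h2 s h
  · obtain ⟨k, rfl⟩ := Nat.exists_eq_add_of_le h
    rw [Nat.add_comm, Function.iterate_add_apply]
    exact h4 k (by omega)

theorem Reaches.single (h : N.step c = c') (hc : c.head ≤ B) (hc' : c'.head ≤ B) :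
    N.Reaches B 1 c c' := by
  refine ⟨h, fun s hs => ?_⟩
  rcases Nat.le_one_iff_eq_zero_or_eq_one.1 hs with rfl | rfl
  · exact hc
  · rw [Function.iterate_one, h]; exact hc'

theorem Reaches.head_le (h : N.Reaches B n c c') (hhalt : N.halting c'.state = true) (s : ℕ) :
    (N.step^[s] c).head ≤ B := by
  rcases le_total s n with hs | hs
  · exact h.2 s hs
  · obtain ⟨k, rfl⟩ := Nat.exists_eq_add_of_le hs
    have hfix : ∀ k, N.step^[k] c' = c' := fun k =>
      Function.iterate_fixed (by simp [step, hhalt]) k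
    rw [Nat.add_comm, Function.iterate_add_apply, h.1, hfix, ← h.1]
    exact h.2 n le_rfl

end QueueLearner

/-! ### A machine that performs one sweep per cycle. -/

/-- The datum symbol and the memory symbol in a cell. -/
def Cell.read {σ ι μ γ : Type} : Cell σ ι μ γ → Option σ × Option μ
  | .input p => p
  | _ => (none, none)

/-- A program for a cycle of the following form. The datum is appended to the queue; then the base
tape is scanned from left to right by a finite automaton while the first record of the queue is
moved to its end, and every scanned cell receives an intermediate symbol; finally, on the way back,
every intermediate symbol is translated into an output symbol, using the final state of the
automaton and the kind of the record. -/
structure PassProgram (σ ι A S W : Type) where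
  init : Option A → S
  next : S → Option σ → Option A → Option σ → S
  emit : S → Option σ → Option A → Option σ → W
  atEnd : S → Bool
  translate : S → Bool → W → A × Option ι

/-- States of the machine that executes a `PassProgram`. -/
inductive PassState (S : Type) where
  | start
  | push (first : Bool)
  | rewind
  | scan (s : Option S) (t : Option Bool)
  | back (s : S) (t : Bool)
  | halt

instance (S : Type) [Finite S] : Finite (PassState S) :=
  Finite.of_surjective
    (fun x : Option (Option (Option (Bool ⊕ (Option S × Option Bool) ⊕ (S × Bool)))) =>
      match x with
      | none => PassState.start
      | some none => .rewind
      | some (some none) => .halt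
      | some (some (some (.inl b))) => .push b
      | some (some (some (.inr (.inl p)))) => .scan p.1 p.2
      | some (some (some (.inr (.inr p)))) => .back p.1 p.2) (by
    rintro (_ | b | _ | ⟨s, t⟩ | ⟨s, t⟩ | _)
    · exact ⟨none, rfl⟩
    · exact ⟨some (some (some (.inl b))), rfl⟩
    · exact ⟨some none, rfl⟩
    · exact ⟨some (some (some (.inr (.inl (s, t))))), rfl⟩
    · exact ⟨some (some (some (.inr (.inr (s, t))))), rfl⟩
    · exact ⟨some (some none), rfl⟩)

namespace PassProgram

variable {σ ι A S W : Type} (P : PassProgram σ ι A S W)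

/-- The letter of the record at the read-end of the queue, unless the record is exhausted. -/
def letter : Option Bool → Option (σ ⊕ Bool) → Option σ
  | none, some (.inl x) => some x
  | _, _ => none

/-- Whether the record is exhausted after reading one more symbol, and its kind in that case. -/
def terminator : Option Bool → Option (σ ⊕ Bool) → Option Bool
  | none, some (.inr b) => some b
  | t, _ => t

/-- The kind of a record is its terminator, which is `true` exactly if the queue was empty at the
start of the cycle. The scan starts with state `none` because the initial automaton state depends on
the memory symbol in the first cell. The last case ends the cycle when the way back arrives at the
marker; its other instances do not occur in the runs considered. -/
def trans : PassState S → Option (Cell σ ι A W) → Option (σ ⊕ Bool) →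
    QueueAction (PassState S) (Cell σ ι A W) (σ ⊕ Bool)
  | .start, _, q => ⟨.push q.isNone, .blank, .right, false, none⟩
  | .push f, some c, _ =>
    match c.read.1 with
    | some x => ⟨.push f, c, .right, false, some (.inl x)⟩
    | none => ⟨.rewind, c, .left, false, some (.inr f)⟩
  | .rewind, none, _ => ⟨.scan none none, .blank, .right, false, none⟩
  | .rewind, some c, _ => ⟨.rewind, c, .left, false, none⟩
  | .scan s t, some c, q =>
    let s := s.getD (P.init c.read.2)
    if P.atEnd s then ⟨.back s (t.getD false), c, .left, false, none⟩
    else ⟨.scan (some (P.next s c.read.1 c.read.2 (letter t q))) (terminator t q),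
      .work (P.emit s c.read.1 c.read.2 (letter t q)), .right, t.isNone,
      if t.isNone then q else none⟩
  | .back s t, some (.work b), _ =>
    ⟨.back s t, .output (some (P.translate s t b).1, (P.translate s t b).2), .left, false, none⟩
  | _, _, _ => ⟨.halt, .blank, .stay, false, none⟩

/-- The machine that executes the program. -/
def toLearner [Finite σ] [Finite A] [Finite S] [Finite W] (m₀ : List A) : QueueLearner σ ι where
  Mem := A
  Work := W
  Queue := σ ⊕ Bool
  State := PassState S
  finite_mem := inferInstance
  finite_work := inferInstance
  finite_queue := inferInstance
  finite_state := inferInstance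
  start := .start
  halting s := match s with
    | .halt => true
    | _ => false
  mem₀ := m₀
  trans := P.trans

/-- The state of the scanning automaton before cell `i`, if the base tape contains the datum `w`
and the memory `m`, and the record moved is `y`. -/
def run (w : List σ) (m : List A) (y : List σ) : ℕ → S
  | 0 => P.init m[0]?
  | i + 1 => P.next (run w m y i) w[i]? m[i]? y[i]?

/-- The intermediate symbol written into cell `i`. -/
def emitted (w : List σ) (m : List A) (y : List σ) (i : ℕ) : W :=
  P.emit (P.run w m y i) w[i]? m[i]? y[i]?

/-- The base tape at the beginning of a cycle. -/
def inputTape (w : List σ) (m : List A) (i : ℕ) : Cell σ ι A W :=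
  ((conv w m)[i]?).elim Cell.blank Cell.input

theorem inputTape_read (w : List σ) (m : List A) (i : ℕ) :
    (inputTape w m i : Cell σ ι A W).read = (w[i]?, m[i]?) := by
  rw [inputTape, conv_getElem?]
  cases w[i]? <;> cases m[i]? <;> rfl

variable [Finite σ] [Finite A] [Finite S] [Finite W] (m₀ : List A)

/-- Configurations of the machine. -/
def cfg (s : PassState S) (h : ℕ) (T : ℕ → Cell σ ι A W) (q : List (σ ⊕ Bool)) :
    (P.toLearner m₀).Cfg := ⟨s, h, T, q⟩

open QueueLearner

/-- The configuration after the action `a`. -/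
def act (h : ℕ) (T : ℕ → Cell σ ι A W) (q : List (σ ⊕ Bool))
    (a : QueueAction (PassState S) (Cell σ ι A W) (σ ⊕ Bool)) : (P.toLearner m₀).Cfg :=
  P.cfg m₀ a.next (moveHead h a.move) (writeAt T h a.write)
    ((if a.pop then q.tail else q) ++ a.push.toList)

theorem step_zero {s : PassState S} (hs : s ≠ .halt) (T : ℕ → Cell σ ι A W)
    (q : List (σ ⊕ Bool)) :
    (P.toLearner m₀).step (P.cfg m₀ s 0 T q) = P.act m₀ 0 T q (P.trans s none q.head?) := by
  cases s
  case halt => exact absurd rfl hs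
  all_goals rfl

theorem step_succ {s : PassState S} (hs : s ≠ .halt) (h : ℕ) (T : ℕ → Cell σ ι A W)
    (q : List (σ ⊕ Bool)) :
    (P.toLearner m₀).step (P.cfg m₀ s (h + 1) T q) =
      P.act m₀ (h + 1) T q (P.trans s (some (T h)) q.head?) := by
  cases s
  case halt => exact absurd rfl hs
  all_goals rfl

theorem reaches_push (w : List σ) (m : List A) (f : Bool) (B : ℕ) (hB : w.length + 1 ≤ B) :
    ∀ (k i : ℕ) (q : List (σ ⊕ Bool)), w.length = i + k →
    (P.toLearner m₀).Reaches B (k + 1) (P.cfg m₀ (.push f) (i + 1) (inputTape w m) q)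
      (P.cfg m₀ .rewind w.length (inputTape w m) (q ++ (w.drop i).map .inl ++ [.inr f])) := by
  intro k
  induction k with
  | zero =>
    intro i q hi
    obtain rfl : i = w.length := by omega
    refine Reaches.single ?_ (by simpa [cfg] using hB) (by simp [cfg]; omega)
    rw [P.step_succ m₀ (by simp)]
    simp [act, trans, inputTape_read, writeAt, moveHead]
  | succ k ih =>
    intro i q hi
    have hlt : i < w.length := by omega
    have h1 := ih (i + 1) (q ++ [.inl w[i]]) (by omega)
    rw [Nat.add_comm (k + 1) 1]
    refine Reaches.trans (Reaches.single (c' := P.cfg m₀ (.push f) (i + 1 + 1) (inputTape w m)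
      (q ++ [.inl w[i]])) ?_ (by simp [cfg]; omega) (by simp [cfg]; omega)) ?_
    · rw [P.step_succ m₀ (by simp)]
      simp [act, trans, inputTape_read, writeAt, moveHead, hlt]
    · rw [List.drop_eq_getElem_cons hlt, List.map_cons]
      rwa [List.append_assoc q, List.singleton_append] at h1

theorem reaches_rewind (T : ℕ → Cell σ ι A W) (q : List (σ ⊕ Bool)) (B : ℕ) (hB : 1 ≤ B) :
    ∀ h : ℕ, h ≤ B → (P.toLearner m₀).Reaches B (h + 1) (P.cfg m₀ .rewind h T q)
      (P.cfg m₀ (.scan none none) 1 T q) := by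
  intro h
  induction h with
  | zero =>
    intro _
    refine Reaches.single ?_ (by simp [cfg]) (by simpa [cfg] using hB)
    rw [P.step_zero m₀ (by simp)]
    simp [act, trans, writeAt, moveHead]
  | succ h ih =>
    intro hh
    rw [Nat.add_comm (h + 1) 1]
    refine Reaches.trans (Reaches.single ?_ (by simpa [cfg] using hh) ?_) (ih (by omega))
    · rw [P.step_succ m₀ (by simp)]
      simp [act, trans, writeAt, moveHead]
    · simp [cfg]; omega

section Scan

variable (w : List σ) (m : List A) (y : List σ) (b : Bool) (rest : List (σ ⊕ Bool))

/-- The configuration when the scan has reached cell `i`. -/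
def scanCfg (i : ℕ) : (P.toLearner m₀).Cfg :=
  P.cfg m₀ (.scan (if i = 0 then none else some (P.run w m y i))
      (if i ≤ y.length then none else some b)) (i + 1)
    (fun j => if j < i then .work (P.emitted w m y j) else inputTape w m j)
    (if i ≤ y.length then (y.drop i).map .inl ++ .inr b :: rest ++ (y.take i).map .inl
      else rest ++ y.map .inl ++ [.inr b])

theorem scan_step (i : ℕ) (hi : P.atEnd (P.run w m y i) = false) :
    (P.toLearner m₀).step (P.scanCfg m₀ w m y b rest i) = P.scanCfg m₀ w m y b rest (i + 1) := by
  have hs : (if i = 0 then none else some (P.run w m y i)).getD (P.init m[i]?) =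
      P.run w m y i := by
    split
    · next h => subst h; rfl
    · rfl
  have htape : ∀ a, a = P.emitted w m y i → Function.update
      (fun j => if j < i then Cell.work (P.emitted w m y j) else inputTape w m j) i (.work a) =
      (fun j => if j < i + 1 then Cell.work (P.emitted w m y j)
        else (inputTape w m j : Cell σ ι A W)) := by
    rintro a rfl
    funext j
    rcases lt_trichotomy j i with h | rfl | h
    · rw [Function.update_of_ne h.ne, if_pos h, if_pos (by omega)]
    · rw [Function.update_self, if_pos (by omega)]
    · rw [Function.update_of_ne h.ne', if_neg (by omega), if_neg (by omega)]
  -- The cell is scanned together with a letter of the record, with its terminator, or after the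
  -- record has been moved completely; in the last case the queue is left alone.
  rcases lt_trichotomy i y.length with h | h | h
  · have h0 : i ≤ y.length := h.le
    have h1 : i + 1 ≤ y.length := h
    have hd : y.drop i = y[i] :: y.drop (i + 1) := List.drop_eq_getElem_cons h
    have ht : y.take (i + 1) = y.take i ++ [y[i]] := List.take_succ_eq_append_getElem h
    have hy : y[i]? = some y[i] := List.getElem?_eq_getElem h
    rw [scanCfg, P.step_succ m₀ (by simp)]
    simp only [scanCfg, act, trans, moveHead, writeAt,
      if_pos h0, if_pos h1, lt_irrefl, if_false, inputTape_read, hs, hi, hd, ht, List.map_cons,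
      List.cons_append, List.head?_cons, letter, terminator, Option.isNone_none, if_true,
      List.tail_cons, Option.toList_some, List.map_append, List.map_nil, Bool.false_eq_true,
      Nat.add_eq_zero_iff, one_ne_zero, and_false, List.append_assoc, run, hy]
    rw [htape _ (by simp [emitted, hy])]
  · have h0 : i ≤ y.length := h.le
    have h1 : ¬ i + 1 ≤ y.length := by omega
    have hd : y.drop i = [] := List.drop_eq_nil_of_le h.ge
    have ht : y.take i = y := List.take_of_length_le h.ge
    have hy : y[i]? = none := List.getElem?_eq_none h.ge
    rw [scanCfg, P.step_succ m₀ (by simp)]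
    simp only [scanCfg, act, trans, moveHead, writeAt,
      if_pos h0, if_neg h1, lt_irrefl, if_false, inputTape_read, hs, hi, hd, ht, List.map_nil,
      List.nil_append, List.cons_append, List.head?_cons, letter, terminator, Option.isNone_none,
      if_true, List.tail_cons, Option.toList_some, Bool.false_eq_true,
      Nat.add_eq_zero_iff, one_ne_zero, and_false, List.append_assoc, run, hy]
    rw [htape _ (by simp [emitted, hy])]
  · have h0 : ¬ i ≤ y.length := by omega
    have h1 : ¬ i + 1 ≤ y.length := by omega
    have hy : y[i]? = none := List.getElem?_eq_none h.le
    rw [scanCfg, P.step_succ m₀ (by simp)]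
    simp only [scanCfg, act, trans, moveHead, writeAt,
      if_neg h0, if_neg h1, lt_irrefl, if_false, inputTape_read, hs, hi,
      letter, terminator, Option.isNone_some, Option.toList_none, Bool.false_eq_true,
      Nat.add_eq_zero_iff, one_ne_zero, and_false, List.append_nil, run, hy]
    rw [htape _ (by simp [emitted, hy])]

theorem reaches_scan (B : ℕ) : ∀ l : ℕ, l + 1 ≤ B → (∀ i < l, P.atEnd (P.run w m y i) = false) →
    (P.toLearner m₀).Reaches B l (P.scanCfg m₀ w m y b rest 0) (P.scanCfg m₀ w m y b rest l) := by
  intro l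
  induction l with
  | zero => intro h _; exact Reaches.refl (by simpa [scanCfg, cfg] using h)
  | succ l ih =>
    intro h hend
    refine Reaches.trans (ih (by omega) fun i hi => hend i (by omega)) (Reaches.single
      (P.scan_step m₀ w m y b rest l (hend l (by omega))) ?_ ?_)
    · simp [scanCfg, cfg]; omega
    · simpa [scanCfg, cfg] using h

/-- The configuration on the way back, when the cells from `i` on have been translated. -/
def backCfg (l i : ℕ) : (P.toLearner m₀).Cfg :=
  P.cfg m₀ (.back (P.run w m y l) b) i
    (fun j => if j < i then .work (P.emitted w m y j) else if j < l then
      .output (some (P.translate (P.run w m y l) b (P.emitted w m y j)).1,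
        (P.translate (P.run w m y l) b (P.emitted w m y j)).2)
      else inputTape w m j) (rest ++ y.map .inl ++ [.inr b])

theorem back_step (l i : ℕ) (hi : i < l) :
    (P.toLearner m₀).step (P.backCfg m₀ w m y b rest l (i + 1)) =
      P.backCfg m₀ w m y b rest l i := by
  rw [backCfg, P.step_succ m₀ (by simp)]
  simp only [backCfg, act, trans, moveHead, writeAt,
    Nat.lt_succ_self, if_true, Bool.false_eq_true, if_false, Option.toList_none, List.append_nil,
    Nat.add_sub_cancel]
  congr 1
  funext j
  rcases lt_trichotomy j i with h | rfl | h
  · rw [Function.update_of_ne h.ne, if_pos h, if_pos (by omega)]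
  · rw [Function.update_self, if_neg (by omega), if_pos hi]
  · rw [Function.update_of_ne h.ne', if_neg (by omega), if_neg h.not_gt]

theorem reaches_back (B l : ℕ) (hB : l ≤ B) : ∀ i ≤ l,
    (P.toLearner m₀).Reaches B i (P.backCfg m₀ w m y b rest l i)
      (P.backCfg m₀ w m y b rest l 0) := by
  intro i
  induction i with
  | zero => intro _; exact Reaches.refl (by simp [backCfg, cfg])
  | succ i ih =>
    intro hi
    have h1 := P.back_step m₀ w m y b rest l i hi
    have h2 : (P.toLearner m₀).Reaches B 1 (P.backCfg m₀ w m y b rest l (i + 1))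
        (P.backCfg m₀ w m y b rest l i) := Reaches.single h1 ?_ ?_
    · have h3 := h2.trans (ih (by omega))
      rwa [Nat.add_comm 1 i] at h3
    · simp [backCfg, cfg]; omega
    · simp [backCfg, cfg]; omega

theorem end_step (l : ℕ) (hl : y.length < l) (hend : P.atEnd (P.run w m y l) = true) :
    (P.toLearner m₀).step (P.scanCfg m₀ w m y b rest l) = P.backCfg m₀ w m y b rest l l := by
  have h0 : ¬ l ≤ y.length := by omega
  have h1 : ¬ l = 0 := by omega
  rw [scanCfg, P.step_succ m₀ (by simp)]
  simp only [backCfg, act, trans, moveHead, writeAt,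
    if_neg h0, if_neg h1, Option.getD_some, hend, if_true, Bool.false_eq_true, if_false,
    Option.toList_none, List.append_nil, Nat.add_sub_cancel, Function.update_eq_self]
  congr 1
  funext j
  by_cases h : j < l <;> simp [h]

/-- The effect of a cycle. -/
theorem cycle_spec (q : List (σ ⊕ Bool)) (l : ℕ)
    (hq : q ++ w.map .inl ++ [.inr q.head?.isNone] = y.map .inl ++ .inr b :: rest)
    (hw : w.length ≤ l) (hm : m.length ≤ l) (hy : y.length < l)
    (hrun : ∀ i < l, P.atEnd (P.run w m y i) = false) (hend : P.atEnd (P.run w m y l) = true)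
    (m' : List A) (h : List ι) (hm' : m'.length = l) (hh : h.length ≤ l)
    (hout : ∀ i < l, m'[i]? = some (P.translate (P.run w m y l) b (P.emitted w m y i)).1 ∧
      h[i]? = (P.translate (P.run w m y l) b (P.emitted w m y i)).2) :
    (P.toLearner m₀).CycleWithin (2 * w.length + 2 * l + 5) m q w m'
        (rest ++ y.map .inl ++ [.inr b]) h ∧
      ∀ s, ((P.toLearner m₀).step^[s] ((P.toLearner m₀).startCfg m q w)).head ≤ l + 1 := by
  let fin : (P.toLearner m₀).Cfg := P.cfg m₀ .halt 0 (P.backCfg m₀ w m y b rest l 0).tape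
    (rest ++ y.map .inl ++ [.inr b])
  have h1 : (P.toLearner m₀).Reaches (l + 1) 1 ((P.toLearner m₀).startCfg m q w)
      (P.cfg m₀ (.push q.head?.isNone) (0 + 1) (inputTape w m) q) := by
    refine Reaches.single ?_ (by simp [startCfg]) (by simp [cfg])
    have : (P.toLearner m₀).startCfg m q w = P.cfg m₀ .start 0 (inputTape w m) q := rfl
    rw [this, P.step_zero m₀ (by simp)]
    simp [act, trans, moveHead, writeAt]
  have h2 := P.reaches_push m₀ w m q.head?.isNone (l + 1) (by omega) w.length 0 q (by omega)
  rw [List.drop_zero, hq] at h2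
  have h3 := P.reaches_rewind m₀ (inputTape w m) (y.map .inl ++ .inr b :: rest) (l + 1) (by omega)
    w.length (by omega)
  have h4 : P.cfg m₀ (.scan none none) 1 (inputTape w m) (y.map .inl ++ .inr b :: rest) =
      P.scanCfg m₀ w m y b rest 0 := by
    simp [scanCfg]
  rw [h4] at h3
  have h5 := P.reaches_scan m₀ w m y b rest (l + 1) l le_rfl hrun
  have h6 : (P.toLearner m₀).Reaches (l + 1) 1 (P.scanCfg m₀ w m y b rest l)
      (P.backCfg m₀ w m y b rest l l) :=
    Reaches.single (P.end_step m₀ w m y b rest l hy hend) (by simp [scanCfg, cfg])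
      (by simp [backCfg, cfg])
  have h7 := P.reaches_back m₀ w m y b rest (l + 1) l (by omega) l le_rfl
  have h8 : (P.toLearner m₀).Reaches (l + 1) 1 (P.backCfg m₀ w m y b rest l 0) fin := by
    refine Reaches.single ?_ (by simp [backCfg, cfg]) (by simp [fin, cfg])
    rw [backCfg, P.step_zero m₀ (by simp)]
    simp only [fin, backCfg, cfg, act, trans, moveHead, writeAt,
      Bool.false_eq_true, if_false, Option.toList_none, List.append_nil]
  have hall := (((((h1.trans h2).trans h3).trans h5).trans h6).trans h7).trans h8
  rw [show 1 + (w.length + 1) + (w.length + 1) + l + 1 + l + 1 = 2 * w.length + 2 * l + 5 by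
    omega] at hall
  refine ⟨?_, hall.head_le rfl⟩
  have hhold : ∀ i, i ≤ (conv m' h).length → (P.backCfg m₀ w m y b rest l 0).tape i =
      (((conv m' h)[i]?).elim Cell.blank Cell.output : Cell σ ι A W) := by
    intro i hi
    rw [conv_length, hm', max_eq_left hh] at hi
    rw [conv_getElem?]
    simp only [cfg, backCfg, Nat.not_lt_zero, if_false]
    rcases hi.lt_or_eq with hlt | rfl
    · rw [if_pos hlt, (hout i hlt).1, (hout i hlt).2]
      cases (P.translate (P.run w m y l) b (P.emitted w m y i)).2 <;> rfl
    -- Cell `l` was never written and lies behind datum and memory, so it supplies the blank that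
    -- ends the output.
    · rw [if_neg (lt_irrefl _), inputTape, conv_getElem?, List.getElem?_eq_none hw,
        List.getElem?_eq_none hm, List.getElem?_eq_none hm'.le, List.getElem?_eq_none hh]
      rfl
  unfold CycleWithin
  rw [hall.1]
  exact ⟨rfl, hhold, rfl⟩

end Scan

end PassProgram

/-! ### Counters with growing length. -/

/-- A cyclic successor function on a finite set of digits, with the digit `z` as zero. -/
structure Odometer (D : Type) (z : D) where
  base : ℕ
  rank : D → ℕ
  succ : D → D
  top : D → Bool
  rank_injective : Function.Injective rank
  rank_zero : rank z = 0
  rank_lt : ∀ d, rank d < base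
  rank_top : ∀ d, top d = true → rank d + 1 = base ∧ succ d = z
  rank_succ : ∀ d, top d = false → rank (succ d) = rank d + 1

theorem Odometer.nonempty (D : Type) [Finite D] (z : D) : Nonempty (Odometer D z) := by
  obtain ⟨n, ⟨f⟩⟩ := Finite.exists_equiv_fin D
  have hn : 0 < n := (f z).pos
  let g : D ≃ Fin n := f.trans (Equiv.swap (f z) ⟨0, hn⟩)
  have hg : g z = ⟨0, hn⟩ := by simp [g]
  exact ⟨{
    base := n
    rank := fun d => g d
    succ := fun d => if h : (g d : ℕ) + 1 < n then g.symm ⟨(g d : ℕ) + 1, h⟩ else z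
    top := fun d => decide ((g d : ℕ) + 1 = n)
    rank_injective := fun a b h => g.injective (Fin.ext h)
    rank_zero := by simp [hg]
    rank_lt := fun d => (g d).isLt
    rank_top := by
      intro d hd
      have := of_decide_eq_true hd
      exact ⟨this, dif_neg (by omega)⟩
    rank_succ := by
      intro d hd
      have := of_decide_eq_false hd
      have h2 := (g d).isLt
      rw [dif_pos (by omega)]
      simp }⟩

namespace Odometer

variable {D : Type} {z : D} (O : Odometer D z)

/-- The carry into position `i` when `c` is added to the number with digits `E`. -/
def carry (c : Bool) (E : ℕ → D) : ℕ → Bool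
  | 0 => c
  | i + 1 => carry c E i && O.top (E i)

/-- The digits after adding `c`, modulo `base ^ l`. -/
def bump (c : Bool) (l : ℕ) (E : ℕ → D) (i : ℕ) : D :=
  if i < l ∧ O.carry c E i = true then O.succ (E i) else E i

/-- The number whose digits are the first `l` entries of `E`, the least significant one first. -/
def val (E : ℕ → D) : ℕ → ℕ
  | 0 => 0
  | l + 1 => val E l + O.rank (E l) * O.base ^ l

theorem carry_false (E : ℕ → D) (i : ℕ) : O.carry false E i = false := by
  induction i with
  | zero => rfl
  | succ i ih => rw [carry, ih, Bool.false_and]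

theorem bump_false (l : ℕ) (E : ℕ → D) : O.bump false l E = E := by
  funext i
  simp [bump, carry_false]

theorem bump_of_le (c : Bool) {l i : ℕ} (E : ℕ → D) (h : l ≤ i) : O.bump c l E i = E i := by
  rw [bump, if_neg]
  omega

theorem val_lt (E : ℕ → D) (l : ℕ) : O.val E l < O.base ^ l := by
  induction l with
  | zero => simp [val]
  | succ l ih =>
    have h1 : (O.rank (E l) + 1) * O.base ^ l ≤ O.base * O.base ^ l :=
      Nat.mul_le_mul_right _ (O.rank_lt (E l))
    rw [Nat.add_mul, one_mul] at h1
    rw [val, pow_succ, Nat.mul_comm (O.base ^ l)]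
    omega

theorem val_congr {E E' : ℕ → D} {l : ℕ} (h : O.val E l = O.val E' l) :
    ∀ i < l, E i = E' i := by
  induction l with
  | zero => intro i hi; omega
  | succ l ih =>
    rw [val, val] at h
    have h1 := O.val_lt E l
    have h2 := O.val_lt E' l
    have hpos : 0 < O.base ^ l := by omega
    have hd : O.rank (E l) = O.rank (E' l) := by
      have := congrArg (· / O.base ^ l) h
      simpa [Nat.add_mul_div_right _ _ hpos, Nat.div_eq_of_lt h1, Nat.div_eq_of_lt h2] using this
    rw [hd, Nat.add_right_cancel_iff] at h
    intro i hi
    rcases (Nat.lt_succ_iff.1 hi).lt_or_eq with hlt | rfl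
    · exact ih h i hlt
    · exact O.rank_injective hd

theorem val_extend {E : ℕ → D} {l l' : ℕ} (h : ∀ i, l ≤ i → E i = z) (hl : l ≤ l') :
    O.val E l' = O.val E l := by
  induction hl with
  | refl => rfl
  | step hl ih => rw [val, ih, h _ hl, O.rank_zero, zero_mul, add_zero]

/-- The invariant of addition with carry: the low `j` digits of the sum together with the carry out
of them account for the low `j` old digits and the initial carry. -/
theorem val_bump (c : Bool) (l : ℕ) (E : ℕ → D) : ∀ j ≤ l,
    O.val (O.bump c l E) j + (if O.carry c E j then O.base ^ j else 0) = O.val E j + c.toNat := by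
  intro j
  induction j with
  | zero => cases c <;> simp [val, carry]
  | succ j ih =>
    intro hj
    have h1 := ih (by omega)
    have hlt : j < l := hj
    rw [val, val, carry, bump]
    cases hc : O.carry c E j with
    | false =>
      simp only [hc, Bool.false_eq_true, if_false, and_false, Bool.false_and] at h1 ⊢
      omega
    | true =>
      simp only [hc, if_true, hlt, and_self, Bool.true_and] at h1 ⊢
      cases ht : O.top (E j) with
      | false =>
        rw [O.rank_succ _ ht, Nat.add_mul, one_mul]
        simp only [Bool.false_eq_true, if_false]
        omega
      | true =>
        obtain ⟨h2, h3⟩ := O.rank_top _ ht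
        rw [h3, O.rank_zero, zero_mul, pow_succ, ← h2, Nat.mul_add, mul_one, h2,
          Nat.mul_comm _ (O.rank (E j))]
        simp only [if_true]
        omega

section Visits

variable {E : ℕ → ℕ → D} {c : ℕ → Bool} {l : ℕ → ℕ}

/-- New high digits are zero, so lengthening does not change the value. Since at most one is added,
an overflow leaves exactly zero, and it can only occur once the value has reached the capacity of
the initial length. -/
theorem val_step (hsupp : ∀ t i, l t ≤ i → E t i = z) (hl : Monotone l)
    (hE : ∀ t, E (t + 1) = O.bump (c t) (l (t + 1)) (E t)) (t : ℕ) :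
    O.val (E (t + 1)) (l (t + 1)) = O.val (E t) (l t) + (c t).toNat ∨
      O.val (E (t + 1)) (l (t + 1)) = 0 ∧
        O.base ^ l 0 ≤ O.val (E t) (l t) + (c t).toNat := by
  have h1 := O.val_bump (c t) (l (t + 1)) (E t) _ le_rfl
  rw [← hE, O.val_extend (hsupp t) (hl (Nat.le_succ t))] at h1
  have h2 := O.val_lt (E t) (l t)
  have hb : 0 < O.base := (Nat.zero_le _).trans_lt (O.rank_lt z)
  have h3 : O.base ^ l t ≤ O.base ^ l (t + 1) := Nat.pow_le_pow_right hb (hl (Nat.le_succ t))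
  have h4 : O.base ^ l 0 ≤ O.base ^ l (t + 1) := Nat.pow_le_pow_right hb (hl (Nat.zero_le _))
  have h5 := Bool.toNat_le (c t)
  split at h1
  · right
    omega
  · left
    omega

/-- The value grows by single units, so it cannot jump over a target `G` that lies above it; only an
overflow can intervene, and that is impossible if `G` is below the initial capacity. -/
theorem exists_val_eq_or (hsupp : ∀ t i, l t ≤ i → E t i = z) (hl : Monotone l)
    (hE : ∀ t, E (t + 1) = O.bump (c t) (l (t + 1)) (E t)) (hc : ∀ t, ∃ t' ≥ t, c t' = true)
    (G : ℕ) : ∀ (k t : ℕ), O.val (E t) (l t) + k = G →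
      ∃ t' ≥ t, O.val (E t') (l t') = G ∨ O.val (E t') (l t') = 0 ∧ O.base ^ l 0 ≤ G := by
  intro k
  induction k with
  | zero => intro t ht; exact ⟨t, le_rfl, Or.inl (by omega)⟩
  | succ k ih =>
    intro t ht
    have hex : ∃ s, c (t + s) = true := by
      obtain ⟨t', ht', h⟩ := hc t
      exact ⟨t' - t, by rwa [Nat.add_sub_cancel' ht']⟩
    classical
    have hconst : ∀ s ≤ Nat.find hex, O.val (E (t + s)) (l (t + s)) = O.val (E t) (l t) := by
      intro s
      induction s with
      | zero => intro _; rfl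
      | succ s ihs =>
        intro hs
        have hf : c (t + s) = false := by
          simpa using Nat.find_min hex (show s < Nat.find hex by omega)
        rw [← ihs (by omega), ← Nat.add_assoc, hE, hf, O.bump_false,
          O.val_extend (hsupp _) (hl (Nat.le_succ _))]
    have hs := hconst _ le_rfl
    have hcs := Nat.find_spec hex
    rcases O.val_step hsupp hl hE (t + Nat.find hex) with h | ⟨h, h'⟩
    · rw [hcs, hs, Bool.toNat_true] at h
      obtain ⟨t', ht', hr⟩ := ih _ (show _ + k = G by rw [h]; omega)
      exact ⟨t', by omega, hr⟩
    · rw [hcs, hs, Bool.toNat_true] at h'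
      exact ⟨_, by omega, Or.inr ⟨h, by omega⟩⟩

end Visits

end Odometer

/-- The first components of the digits spell the word `w`. -/
def Spells {α : Type} (E : ℕ → Option α × Bool) (w : List α) : Prop := ∀ i : ℕ, (E i).1 = w[i]?

theorem Spells.unique {α : Type} {E : ℕ → Option α × Bool} {w w' : List α} (h : Spells E w)
    (h' : Spells E w') : w = w' :=
  List.ext_getElem? fun i => (h i).symm.trans (h' i)

/-- A counter that is increased infinitely often spells every word infinitely often, whether or
not it overflows. -/
theorem Odometer.exists_spells {α : Type} (O : Odometer (Option α × Bool) (none, false))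
    {E : ℕ → ℕ → Option α × Bool} {c : ℕ → Bool} {l : ℕ → ℕ}
    (hsupp : ∀ t i, l t ≤ i → E t i = (none, false)) (hl : Monotone l)
    (hE : ∀ t, E (t + 1) = O.bump (c t) (l (t + 1)) (E t)) (hc : ∀ t, ∃ t' ≥ t, c t' = true)
    (w : List α) (hw : w.length ≤ l 0) : ∃ t, Spells (E t) w := by
  have key : ∀ (p : ℕ → Bool) (n t : ℕ), (∀ i, n ≤ i → p i = false) → w.length ≤ n →
      O.val (E t) (l t) = O.val (fun i => (w[i]?, p i)) n → Spells (E t) w := by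
    intro p n t hp hn h i
    have hz : ∀ i, n ≤ i → (fun i => (w[i]?, p i)) i = (none, false) := by
      intro i hi
      simp [hp i hi, List.getElem?_eq_none (hn.trans hi)]
    rw [← O.val_extend (hsupp t) (le_max_left (l t) n),
      ← O.val_extend hz (le_max_right (l t) n)] at h
    by_cases hi : i < max (l t) n
    · rw [O.val_congr h i hi]
    · rw [hsupp t i (by omega), List.getElem?_eq_none (by omega)]
  have hb : 1 < O.base := by
    have h1 := O.rank_lt (none, true)
    have h2 : O.rank (none, true) ≠ O.rank (none, false) := fun h => by
      simpa using O.rank_injective h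
    rw [O.rank_zero] at h2
    omega
  -- The spare bit at position `p`, behind `w`, makes a number that spells `w` and exceeds the
  -- current value. If the counter overflows before reaching it, it restarts from zero and meets the
  -- plain representation `G'`, which is below the initial capacity.
  let p := max w.length (O.val (E 0) (l 0))
  let G := O.val (fun i => ((w[i]? : Option α), decide (i = p))) (p + 1)
  have hG : O.val (E 0) (l 0) ≤ G := by
    have h1 : O.rank (w[p]?, decide (p = p)) ≠ 0 := by
      rw [← O.rank_zero]
      intro h
      simpa using O.rank_injective h
    have h2 : p < O.base ^ p := Nat.lt_pow_self hb
    have h3 : O.base ^ p ≤ O.rank (w[p]?, decide (p = p)) * O.base ^ p :=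
      Nat.le_mul_of_pos_left _ (by omega)
    have h4 : O.val (E 0) (l 0) ≤ p := le_max_right _ _
    change _ ≤ O.val _ p + O.rank (w[p]?, decide (p = p)) * O.base ^ p
    omega
  obtain ⟨k, hk⟩ := Nat.exists_eq_add_of_le hG
  obtain ⟨t, -, h | ⟨h, -⟩⟩ := O.exists_val_eq_or hsupp hl hE hc G k 0 hk.symm
  · refine ⟨t, key _ (p + 1) t ?_ ?_ h⟩
    · intro i hi
      simp; omega
    · have : w.length ≤ p := le_max_left _ _
      omega
  · let G' := O.val (fun i => ((w[i]? : Option α), false)) w.length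
    obtain ⟨t', -, h' | ⟨-, h'⟩⟩ := O.exists_val_eq_or hsupp hl hE hc G' G' t (by omega)
    · exact ⟨t', key (fun _ => false) w.length t' (fun _ _ => rfl) le_rfl h'⟩
    · have h1 : G' < O.base ^ w.length := O.val_lt _ _
      have h2 : O.base ^ w.length ≤ O.base ^ l 0 := Nat.pow_le_pow_right (by omega) hw
      omega

/-! ### The learner's program and its specification. -/

/-- What is remembered from one cycle to the next: whether the candidate has been rejected and
whether the test word is to be changed, and, for the current pass through the queue, whether the
test word has been found and whether the candidate has been found to be inconsistent. -/
structure Mode where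
  rej : Bool
  adv : Bool
  found : Bool
  bad : Bool

instance : Finite Mode :=
  Finite.of_injective (fun m : Mode => (m.rej, m.adv, m.found, m.bad)) (by
    rintro ⟨⟩ ⟨⟩ h
    simpa using h)

/-- A symbol of the long term memory: digits of the counters for the candidate and for the test
word, and a letter of the hypothesis. Positions below the length of the longest datum are
marked as core. -/
structure Letter (σ ι : Type) where
  core : Bool
  cand : Option ι × Bool
  test : Option σ × Bool
  hyp : Option ι
  mode : Mode

instance (σ ι : Type) [Finite σ] [Finite ι] : Finite (Letter σ ι) :=
  Finite.of_injective (fun m : Letter σ ι => (m.core, m.cand, m.test, m.hyp, m.mode)) (by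
    rintro ⟨⟩ ⟨⟩ h
    simpa using h)

/-- The state of the automaton that scans the base tape. -/
structure ScanState (Q : Type) (C g : ℕ) where
  mode : Mode
  carryCand : Bool
  carryTest : Bool
  margin : Fin (C + 1)
  gap : Fin (g + 1)
  endedCand : Bool
  validCand : Bool
  endedTest : Bool
  validTest : Bool
  short : Bool
  same : Bool
  stCand : Q
  stTest : Q

instance (Q : Type) (C g : ℕ) [Finite Q] : Finite (ScanState Q C g) :=
  Finite.of_injective (fun m : ScanState Q C g => (m.mode, m.carryCand, m.carryTest, m.margin,
    m.gap, m.endedCand, m.validCand, m.endedTest, m.validTest, m.short, m.same, m.stCand,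
    m.stTest)) (by
    rintro ⟨⟩ ⟨⟩ h
    simpa using h)

namespace AutomaticLearner

variable {σ ι Q : Type}

/-- Increment up to the largest element. -/
def incr {n : ℕ} (j : Fin (n + 1)) : Fin (n + 1) := ⟨min (j + 1) n, by omega⟩

/-- One step of an automaton on a convolution, which ignores positions behind its end. -/
def stepConv (A : DFA (Option ι × Option σ) Q) (q : Q) : Option ι → Option σ → Q
  | none, none => q
  | a, b => A.step q (a, b)

theorem eval_take_conv (A : DFA (Option ι × Option σ) Q) (e : List ι) (x : List σ) (i : ℕ) :
    A.eval ((conv e x).take (i + 1)) = stepConv A (A.eval ((conv e x).take i)) e[i]? x[i]? := by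
  rw [List.take_add_one, conv_getElem?]
  cases e[i]? <;> cases x[i]? <;> simp [stepConv]

def candOf (a : Option (Letter σ ι)) : Option ι × Bool := a.elim (none, false) Letter.cand

def testOf (a : Option (Letter σ ι)) : Option σ × Bool := a.elim (none, false) Letter.test

def coreOf (w : Option σ) (a : Option (Letter σ ι)) : Bool := w.isSome || a.elim false Letter.core

open Classical in
/-- One step of the scan, given the new digits of the counters. -/
noncomputable def scanNext (A : DFA (Option ι × Option σ) Q) {C g : ℕ} (s : ScanState Q C g)
    (carryCand carryTest core : Bool) (d : Option ι) (x y : Option σ) : ScanState Q C g where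
  mode := s.mode
  carryCand := carryCand
  carryTest := carryTest
  margin := if core then s.margin else incr s.margin
  gap := if d.isNone then incr s.gap else s.gap
  endedCand := d.isNone
  validCand := s.validCand && !(s.endedCand && d.isSome)
  endedTest := x.isNone
  validTest := s.validTest && !(s.endedTest && x.isSome)
  short := s.short && !(x.isSome && decide (s.gap.val = g))
  same := s.same && decide (x = y)
  stCand := stepConv A s.stCand d y
  stTest := stepConv A s.stTest d x

open Classical in
/-- The candidate is well-formed, sufficiently short and consistent with the current record. -/
noncomputable def fitsFlag (A : DFA (Option ι × Option σ) Q) {C g : ℕ} (s : ScanState Q C g) :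
    Bool :=
  s.validCand && decide (s.gap.val = g) && decide (s.stCand ∈ A.accept)

open Classical in
/-- The test word belongs to the tell-tale set of the candidate. -/
noncomputable def demandFlag (A : DFA (Option ι × Option σ) Q) {C g : ℕ} (s : ScanState Q C g) :
    Bool :=
  s.validTest && s.short && decide (s.stTest ∈ A.accept)

/-- The mode after a cycle. -/
def nextMode (m : Mode) (t fits demand same : Bool) : Mode :=
  if t then ⟨m.bad || !fits || (demand && !(m.found || same)), true, false, false⟩
  else ⟨false, false, m.found || same, m.bad || !fits⟩

/-- The program of the learner. -/
noncomputable def program (A : DFA (Option ι × Option σ) Q)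
    (O : Odometer (Option ι × Bool) (none, false)) (O' : Odometer (Option σ × Bool) (none, false))
    (C g : ℕ) : PassProgram σ ι (Letter σ ι) (ScanState Q C g) (Letter σ ι) where
  -- Every memory letter carries the mode, so the first one suffices. A rejection or advance decided
  -- in the previous cycle enters as the initial carry of the respective counter. The increment is
  -- thus part of the same sweep that checks the new digits.
  init a :=
    let m := a.elim ⟨false, false, false, false⟩ Letter.mode
    { mode := m
      carryCand := m.rej
      carryTest := m.adv
      margin := 0
      gap := 0
      endedCand := false
      validCand := true
      endedTest := false
      validTest := true
      short := true
      same := true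
      stCand := A.start
      stTest := A.start }
  next s w a y :=
    scanNext A s (s.carryCand && O.top (candOf a)) (s.carryTest && O'.top (testOf a)) (coreOf w a)
      (if s.carryCand then O.succ (candOf a) else candOf a).1
      (if s.carryTest then O'.succ (testOf a) else testOf a).1 y
  emit s w a _ :=
    { core := coreOf w a
      cand := if s.carryCand then O.succ (candOf a) else candOf a
      test := if s.carryTest then O'.succ (testOf a) else testOf a
      hyp := a.bind Letter.hyp
      mode := s.mode }
  atEnd s := decide (s.margin.val = C)
  translate s t b :=
    let h := if fitsFlag A s then b.cand.1 else b.hyp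
    ({ b with
        hyp := h
        mode := nextMode s.mode t (fitsFlag A s) (demandFlag A s) s.same }, h)

theorem translate_eq (A : DFA (Option ι × Option σ) Q)
    (O : Odometer (Option ι × Bool) (none, false)) (O' : Odometer (Option σ × Bool) (none, false))
    (C g : ℕ) (s : ScanState Q C g) (t : Bool) (b : Letter σ ι) :
    (program A O O' C g).translate s t b =
      ({ b with
          hyp := if fitsFlag A s then b.cand.1 else b.hyp
          mode := nextMode s.mode t (fitsFlag A s) (demandFlag A s) s.same },
        if fitsFlag A s then b.cand.1 else b.hyp) := rfl

/-- The content of the long term memory: length of the longest datum, counters for the candidate and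
for the test word, hypothesis, and mode. -/
structure Conf (σ ι : Type) where
  size : ℕ
  cand : ℕ → Option ι × Bool
  test : ℕ → Option σ × Bool
  hyp : List ι
  mode : Mode

/-- The word on the base tape that represents the content of the long term memory. -/
def Conf.mem (C : ℕ) (s : Conf σ ι) : List (Letter σ ι) :=
  (List.range (s.size + C)).map fun i =>
    ⟨decide (i < s.size), s.cand i, s.test i, s.hyp[i]?, s.mode⟩

/-- The contents fit into the word of length `s.size + C`. -/
structure Conf.WellFormed (C : ℕ) (s : Conf σ ι) : Prop where
  cand : ∀ i, s.size + C ≤ i → s.cand i = (none, false)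
  test : ∀ i, s.size + C ≤ i → s.test i = (none, false)
  hyp : s.hyp.length ≤ s.size + C

/-- The digits `E` spell an index `e` that is at least `g` shorter than `l`, and whose language
contains `y`. -/
def Fits (A : DFA (Option ι × Option σ) Q) (g : ℕ) (E : ℕ → Option ι × Bool) (l : ℕ)
    (y : List σ) (e : List ι) : Prop :=
  Spells E e ∧ e.length + g ≤ l ∧ A.eval (conv e y) ∈ A.accept

/-- The digits `X` spell a word in the tell-tale set of the index spelled by `E`. -/
def Demands (A : DFA (Option ι × Option σ) Q) (g : ℕ) (E : ℕ → Option ι × Bool)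
    (X : ℕ → Option σ × Bool) : Prop :=
  ∃ e x, Spells E e ∧ Spells X x ∧ x.length ≤ e.length + g ∧ A.eval (conv e x) ∈ A.accept

open Classical in
/-- The effect of a cycle with datum `w` and record `y` of kind `t`. -/
noncomputable def Conf.next (A : DFA (Option ι × Option σ) Q)
    (O : Odometer (Option ι × Bool) (none, false)) (O' : Odometer (Option σ × Bool) (none, false))
    (C g : ℕ) (s : Conf σ ι) (w y : List σ) (t : Bool) : Conf σ ι :=
  let l := max s.size w.length + C
  let E := O.bump s.mode.rej l s.cand
  let X := O'.bump s.mode.adv l s.test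
  { size := max s.size w.length
    cand := E
    test := X
    hyp := if h : ∃ e, Fits A g E l y e then h.choose else s.hyp
    mode := nextMode s.mode t (decide (∃ e, Fits A g E l y e)) (decide (Demands A g E X))
      (decide (Spells X y)) }

theorem exists_word {α : Type} (l : ℕ) : ∀ F : ℕ → Option α,
    (∀ i, F i = none → F (i + 1) = none) → F l = none → ∃ e : List α, ∀ i : ℕ, F i = e[i]? := by
  induction l with
  | zero =>
    intro F hF hl
    refine ⟨[], fun i => ?_⟩
    rw [List.getElem?_nil]
    induction i with
    | zero => exact hl
    | succ i ih => exact hF i ih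
  | succ l ih =>
    intro F hF hl
    cases h0 : F 0 with
    | none =>
      refine ⟨[], fun i => ?_⟩
      rw [List.getElem?_nil]
      induction i with
      | zero => exact h0
      | succ i ih => exact hF i ih
    | some a =>
      obtain ⟨e, he⟩ := ih (fun i => F (i + 1)) (fun i => hF (i + 1)) hl
      refine ⟨a :: e, fun i => ?_⟩
      cases i with
      | zero => simpa using h0
      | succ i => simpa using he i

/-- Digits spell a word iff no letter follows an empty digit; one bit of delay (`en`) lets a finite
automaton check this. -/
theorem valid_iff {α : Type} {l : ℕ} {F : ℕ → Option α} {en va : ℕ → Bool}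
    (hen : en 0 = false) (hva : va 0 = true) (hen' : ∀ i < l, en (i + 1) = (F i).isNone)
    (hva' : ∀ i < l, va (i + 1) = (va i && !(en i && (F i).isSome)))
    (hF : ∀ i, l ≤ i → F i = none) : va l = true ↔ ∃ e : List α, ∀ i : ℕ, F i = e[i]? := by
  have key : ∀ i ≤ l, va i = true ↔ ∀ j, j + 1 < i → F j = none → F (j + 1) = none := by
    intro i
    induction i with
    | zero => simp [hva]
    | succ i ih =>
      intro hi
      rw [hva' i hi, Bool.and_eq_true, ih (by omega)]
      constructor
      · rintro ⟨h1, h2⟩ j hj hn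
        rcases (Nat.lt_succ_iff.1 hj).lt_or_eq with hlt | heq
        · exact h1 j hlt hn
        · subst heq
          rw [hen' j (by omega), hn] at h2
          simpa using h2
      · intro h
        refine ⟨fun j hj => h j (by omega), ?_⟩
        cases i with
        | zero => simp [hen]
        | succ i =>
          rw [hen' i (by omega)]
          cases hn : F i with
          | some a => rfl
          | none => simp [h i (by omega) hn]
  rw [key l le_rfl]
  constructor
  · intro h
    refine exists_word l F (fun i hi => ?_) (hF l le_rfl)
    by_cases hlt : i + 1 < l
    · exact h i hlt hi
    · exact hF _ (by omega)
  · rintro ⟨e, he⟩ j _ hn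
    rw [he, List.getElem?_eq_none_iff] at hn ⊢
    omega

/-! ### Correctness of a single cycle. -/

section Cycle

variable (A : DFA (Option ι × Option σ) Q) (O : Odometer (Option ι × Bool) (none, false))
  (O' : Odometer (Option σ × Bool) (none, false)) {C g : ℕ} {s : Conf σ ι}

theorem candOf_mem (hs : s.WellFormed C) (i : ℕ) : candOf (s.mem C)[i]? = s.cand i := by
  by_cases h : i < s.size + C
  · simp [candOf, Conf.mem, h]
  · rw [hs.cand i (by omega), List.getElem?_eq_none (by simp [Conf.mem]; omega)]
    rfl

theorem testOf_mem (hs : s.WellFormed C) (i : ℕ) : testOf (s.mem C)[i]? = s.test i := by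
  by_cases h : i < s.size + C
  · simp [testOf, Conf.mem, h]
  · rw [hs.test i (by omega), List.getElem?_eq_none (by simp [Conf.mem]; omega)]
    rfl

theorem hyp_mem (hs : s.WellFormed C) (i : ℕ) : (s.mem C)[i]?.bind Letter.hyp = s.hyp[i]? := by
  by_cases h : i < s.size + C
  · simp [Conf.mem, h]
  · have := hs.hyp
    rw [List.getElem?_eq_none (l := s.hyp) (by omega),
      List.getElem?_eq_none (by simp [Conf.mem]; omega)]
    rfl

theorem coreOf_mem (w : List σ) (i : ℕ) :
    coreOf w[i]? (s.mem C)[i]? = decide (i < max s.size w.length) := by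
  have h1 : (w[i]?).isSome = decide (i < w.length) := by
    by_cases h : i < w.length <;> simp [h]
  have h2 : (s.mem C)[i]?.elim false Letter.core = decide (i < s.size) := by
    by_cases h : i < s.size + C
    · simp [Conf.mem, h]
    · rw [List.getElem?_eq_none (by simp [Conf.mem]; omega)]
      simp; omega
  rw [coreOf, h1, h2, ← Bool.decide_or]
  congr 1
  simp only [lt_max_iff, or_comm]

variable (w y : List σ) (t : Bool)

theorem run_mode_carry (hs : s.WellFormed C) (hC : 0 < C) (i : ℕ) :
    ((program A O O' C g).run w (s.mem C) y i).mode = s.mode ∧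
    ((program A O O' C g).run w (s.mem C) y i).carryCand = O.carry s.mode.rej s.cand i ∧
    ((program A O O' C g).run w (s.mem C) y i).carryTest = O'.carry s.mode.adv s.test i := by
  induction i with
  | zero =>
    have : (s.mem C)[0]? = some ⟨decide (0 < s.size), s.cand 0, s.test 0, s.hyp[0]?, s.mode⟩ := by
      simp [Conf.mem, hC]
    simp [PassProgram.run, program, Odometer.carry, this]
  | succ i ih =>
    obtain ⟨h1, h2, h3⟩ := ih
    refine ⟨h1, ?_, ?_⟩
    · simp only [PassProgram.run, program, scanNext] at h2 ⊢
      rw [h2, candOf_mem hs, Odometer.carry]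
    · simp only [PassProgram.run, program, scanNext] at h3 ⊢
      rw [h3, testOf_mem hs, Odometer.carry]

theorem run_succ (hs : s.WellFormed C) (hC : 0 < C) (i : ℕ)
    (hi : i < max s.size w.length + C) :
    (program A O O' C g).run w (s.mem C) y (i + 1) =
      scanNext A ((program A O O' C g).run w (s.mem C) y i) (O.carry s.mode.rej s.cand (i + 1))
        (O'.carry s.mode.adv s.test (i + 1)) (decide (i < max s.size w.length))
        ((s.next A O O' C g w y t).cand i).1 ((s.next A O O' C g w y t).test i).1 y[i]? := by
  obtain ⟨-, h2, h3⟩ := run_mode_carry A O O' w y hs hC (g := g) i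
  rw [PassProgram.run]
  simp only [program, Conf.next, Odometer.bump, hi, true_and] at h2 h3 ⊢
  rw [h2, h3, candOf_mem hs, testOf_mem hs, coreOf_mem]
  rfl

theorem emitted_eq (hs : s.WellFormed C) (hC : 0 < C) (i : ℕ)
    (hi : i < max s.size w.length + C) :
    (program A O O' C g).emitted w (s.mem C) y i =
      ⟨decide (i < max s.size w.length), (s.next A O O' C g w y t).cand i,
        (s.next A O O' C g w y t).test i, s.hyp[i]?, s.mode⟩ := by
  obtain ⟨h1, h2, h3⟩ := run_mode_carry A O O' w y hs hC (g := g) i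
  rw [PassProgram.emitted]
  simp only [program, Conf.next, Odometer.bump, hi, true_and] at h1 h2 h3 ⊢
  rw [h1, h2, h3, candOf_mem hs, testOf_mem hs, coreOf_mem, hyp_mem hs]

/-- This shows where the sweep ends: `C` cells after the core, found without knowing the length of
the longest datum. -/
theorem run_margin (hs : s.WellFormed C) (hC : 0 < C) : ∀ i ≤ max s.size w.length + C,
    ((program A O O' C g).run w (s.mem C) y i).margin.val = min (i - max s.size w.length) C := by
  intro i
  induction i with
  | zero => intro _; simp [PassProgram.run, program]
  | succ i ih =>
    intro hi
    rw [run_succ A O O' w y true hs hC i hi, scanNext]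
    have := ih (by omega)
    by_cases h : i < max s.size w.length
    · simp only [h, decide_true, if_true]
      omega
    · simp only [h, decide_false, Bool.false_eq_true, if_false, incr]
      omega

theorem next_cand_of_le (hs : s.WellFormed C) (i : ℕ) (hi : max s.size w.length + C ≤ i) :
    (s.next A O O' C g w y t).cand i = (none, false) := by
  simp only [Conf.next]
  rw [O.bump_of_le _ _ hi, hs.cand i (by omega)]

theorem next_test_of_le (hs : s.WellFormed C) (i : ℕ) (hi : max s.size w.length + C ≤ i) :
    (s.next A O O' C g w y t).test i = (none, false) := by
  simp only [Conf.next]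
  rw [O'.bump_of_le _ _ hi, hs.test i (by omega)]

theorem run_validCand (hs : s.WellFormed C) (hC : 0 < C) :
    ((program A O O' C g).run w (s.mem C) y (max s.size w.length + C)).validCand = true ↔
      ∃ e, Spells (s.next A O O' C g w y t).cand e := by
  refine valid_iff (F := fun i => ((s.next A O O' C g w y t).cand i).1)
    (en := fun i => ((program A O O' C g).run w (s.mem C) y i).endedCand)
    (va := fun i => ((program A O O' C g).run w (s.mem C) y i).validCand) rfl rfl ?_ ?_ ?_
  · intro i hi
    simp only [run_succ A O O' w y t hs hC i hi, scanNext]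
  · intro i hi
    simp only [run_succ A O O' w y t hs hC i hi, scanNext]
  · intro i hi
    simp only [next_cand_of_le A O O' w y t hs i hi]

theorem run_validTest (hs : s.WellFormed C) (hC : 0 < C) :
    ((program A O O' C g).run w (s.mem C) y (max s.size w.length + C)).validTest = true ↔
      ∃ x, Spells (s.next A O O' C g w y t).test x := by
  refine valid_iff (F := fun i => ((s.next A O O' C g w y t).test i).1)
    (en := fun i => ((program A O O' C g).run w (s.mem C) y i).endedTest)
    (va := fun i => ((program A O O' C g).run w (s.mem C) y i).validTest) rfl rfl ?_ ?_ ?_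
  · intro i hi
    simp only [run_succ A O O' w y t hs hC i hi, scanNext]
  · intro i hi
    simp only [run_succ A O O' w y t hs hC i hi, scanNext]
  · intro i hi
    simp only [next_test_of_le A O O' w y t hs i hi]

theorem run_gap (hs : s.WellFormed C) (hC : 0 < C) {e : List ι}
    (he : Spells (s.next A O O' C g w y t).cand e) : ∀ i ≤ max s.size w.length + C,
    ((program A O O' C g).run w (s.mem C) y i).gap.val = min (i - e.length) g := by
  intro i
  induction i with
  | zero => intro _; simp [PassProgram.run, program]
  | succ i ih =>
    intro hi
    rw [run_succ A O O' w y t hs hC i hi, scanNext]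
    have := ih (by omega)
    simp only [he i]
    by_cases h : i < e.length
    · simp only [List.getElem?_eq_getElem h, Option.isNone_some, Bool.false_eq_true, if_false]
      omega
    · simp only [List.getElem?_eq_none (Nat.le_of_not_lt h), Option.isNone_none, if_true, incr]
      omega

/-- The saturated gap recognises the positions from `e.length + g` on. For `g = 0` it would be
saturated from the start, hence `0 < g`. -/
theorem run_short (hs : s.WellFormed C) (hC : 0 < C) (hg : 0 < g) {e : List ι} {x : List σ}
    (he : Spells (s.next A O O' C g w y t).cand e)
    (hx : Spells (s.next A O O' C g w y t).test x) : ∀ i ≤ max s.size w.length + C,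
    ((program A O O' C g).run w (s.mem C) y i).short = true ↔
      min i x.length ≤ e.length + g := by
  intro i
  induction i with
  | zero => intro _; simp [PassProgram.run, program]
  | succ i ih =>
    intro hi
    have h1 := run_gap A O O' w y t hs hC he i (by omega)
    rw [run_succ A O O' w y t hs hC i hi, scanNext]
    simp only [Bool.and_eq_true, ih (by omega), hx i, h1]
    by_cases h : i < x.length
    · simp only [List.getElem?_eq_getElem h, Option.isSome_some, Bool.true_and, Bool.not_eq_true',
        decide_eq_false_iff_not]
      omega
    · simp only [List.getElem?_eq_none (Nat.le_of_not_lt h), Option.isSome_none, Bool.false_and,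
        Bool.not_false, and_true]
      omega

theorem run_same (hs : s.WellFormed C) (hC : 0 < C)
    (hy : y.length ≤ max s.size w.length + C) :
    ((program A O O' C g).run w (s.mem C) y (max s.size w.length + C)).same = true ↔
      Spells (s.next A O O' C g w y t).test y := by
  have key : ∀ i ≤ max s.size w.length + C,
      ((program A O O' C g).run w (s.mem C) y i).same = true ↔
      ∀ j < i, ((s.next A O O' C g w y t).test j).1 = y[j]? := by
    intro i
    induction i with
    | zero => intro _; simp [PassProgram.run, program]
    | succ i ih =>
      intro hi
      rw [run_succ A O O' w y t hs hC i hi, scanNext]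
      simp only [Bool.and_eq_true, ih (by omega), decide_eq_true_eq, Nat.lt_succ_iff_lt_or_eq,
        or_imp, forall_and, forall_eq]
  rw [key _ le_rfl]
  refine ⟨fun h j => ?_, fun h j _ => h j⟩
  by_cases hj : j < max s.size w.length + C
  · exact h j hj
  · rw [next_test_of_le A O O' w y t hs j (by omega), List.getElem?_eq_none (by omega)]

theorem run_stCand (hs : s.WellFormed C) (hC : 0 < C) {e : List ι}
    (he : Spells (s.next A O O' C g w y t).cand e) : ∀ i ≤ max s.size w.length + C,
    ((program A O O' C g).run w (s.mem C) y i).stCand = A.eval ((conv e y).take i) := by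
  intro i
  induction i with
  | zero => intro _; rfl
  | succ i ih =>
    intro hi
    rw [run_succ A O O' w y t hs hC i hi, scanNext, eval_take_conv]
    simp only [ih (by omega), he i]

theorem run_stTest (hs : s.WellFormed C) (hC : 0 < C) {e : List ι} {x : List σ}
    (he : Spells (s.next A O O' C g w y t).cand e)
    (hx : Spells (s.next A O O' C g w y t).test x) : ∀ i ≤ max s.size w.length + C,
    ((program A O O' C g).run w (s.mem C) y i).stTest = A.eval ((conv e x).take i) := by
  intro i
  induction i with
  | zero => intro _; rfl
  | succ i ih =>
    intro hi
    rw [run_succ A O O' w y t hs hC i hi, scanNext, eval_take_conv]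
    simp only [ih (by omega), he i, hx i]

theorem Spells.length_le {α : Type} {E : ℕ → Option α × Bool} {e : List α} {l : ℕ}
    (he : Spells E e) (hE : ∀ i, l ≤ i → E i = (none, false)) : e.length ≤ l := by
  have := he l
  rw [hE l le_rfl] at this
  exact List.getElem?_eq_none_iff.1 this.symm

theorem fitsFlag_iff (hs : s.WellFormed C) (hC : 0 < C)
    (hy : y.length ≤ max s.size w.length + C) :
    fitsFlag A ((program A O O' C g).run w (s.mem C) y (max s.size w.length + C)) = true ↔
      ∃ e, Fits A g (s.next A O O' C g w y t).cand (max s.size w.length + C) y e := by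
  have key : ∀ e, Spells (s.next A O O' C g w y t).cand e →
      ((((program A O O' C g).run w (s.mem C) y (max s.size w.length + C)).gap.val = g ∧
        ((program A O O' C g).run w (s.mem C) y (max s.size w.length + C)).stCand ∈ A.accept) ↔
      (e.length + g ≤ max s.size w.length + C ∧ A.eval (conv e y) ∈ A.accept)) := by
    intro e he
    have hel := Spells.length_le he (next_cand_of_le A O O' w y t hs)
    rw [run_gap A O O' w y t hs hC he _ le_rfl, run_stCand A O O' w y t hs hC he _ le_rfl,
      List.take_of_length_le (by rw [conv_length]; exact max_le hel hy)]
    refine and_congr_left fun _ => ?_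
    omega
  simp only [fitsFlag, Bool.and_eq_true, decide_eq_true_eq, run_validCand A O O' w y t hs hC,
    and_assoc]
  constructor
  · rintro ⟨⟨e, he⟩, h⟩
    exact ⟨e, he, (key e he).1 h⟩
  · rintro ⟨e, he, h⟩
    exact ⟨⟨e, he⟩, (key e he).2 h⟩

/-- The flag does not itself check that the candidate digits are well-formed; this is where `hfit`
is needed. -/
theorem demandFlag_iff (hs : s.WellFormed C) (hC : 0 < C) (hg : 0 < g)
    (hfit : ∃ e, Spells (s.next A O O' C g w y t).cand e) :
    demandFlag A ((program A O O' C g).run w (s.mem C) y (max s.size w.length + C)) = true ↔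
      Demands A g (s.next A O O' C g w y t).cand (s.next A O O' C g w y t).test := by
  obtain ⟨e, he⟩ := hfit
  have hel := Spells.length_le he (next_cand_of_le A O O' w y t hs)
  have key : ∀ x, Spells (s.next A O O' C g w y t).test x →
      ((((program A O O' C g).run w (s.mem C) y (max s.size w.length + C)).short = true ∧
        ((program A O O' C g).run w (s.mem C) y (max s.size w.length + C)).stTest ∈ A.accept) ↔
      (x.length ≤ e.length + g ∧ A.eval (conv e x) ∈ A.accept)) := by
    intro x hx
    have hxl := Spells.length_le hx (next_test_of_le A O O' w y t hs)
    rw [run_short A O O' w y t hs hC hg he hx _ le_rfl, min_eq_right hxl,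
      run_stTest A O O' w y t hs hC he hx _ le_rfl,
      List.take_of_length_le (by rw [conv_length]; exact max_le hel hxl)]
  simp only [demandFlag, Bool.and_eq_true, decide_eq_true_eq, run_validTest A O O' w y t hs hC,
    and_assoc]
  constructor
  · rintro ⟨⟨x, hx⟩, h⟩
    exact ⟨e, x, he, hx, (key x hx).1 h⟩
  · rintro ⟨e', x, he', hx, h⟩
    obtain rfl := he.unique he'
    exact ⟨⟨x, hx⟩, (key x hx).2 h⟩

theorem Conf.WellFormed.next (hs : s.WellFormed C) : (s.next A O O' C g w y t).WellFormed C := by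
  refine ⟨next_cand_of_le A O O' w y t hs, next_test_of_le A O O' w y t hs, ?_⟩
  simp only [Conf.next]
  split
  · next h => exact (Nat.le_add_right _ _).trans h.choose_spec.2.1
  · have := hs.hyp
    omega

/-- The machine performs a cycle as specified by `Conf.next`. -/
theorem program_cycle [Finite σ] [Finite ι] [Finite Q] (m₀ : List (Letter σ ι))
    (hs : s.WellFormed C) (hC : 0 < C) (hg : 0 < g) (q rest : List (σ ⊕ Bool))
    (hq : q ++ w.map .inl ++ [.inr q.head?.isNone] = y.map .inl ++ .inr t :: rest)
    (hy : y.length ≤ max s.size w.length) :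
    ((program A O O' C g).toLearner m₀).CycleWithin
        (2 * w.length + 2 * (max s.size w.length + C) + 5) (s.mem C) q w
        ((s.next A O O' C g w y t).mem C) (rest ++ y.map .inl ++ [.inr t])
        (s.next A O O' C g w y t).hyp ∧
      ∀ n, (((program A O O' C g).toLearner m₀).step^[n]
        (((program A O O' C g).toLearner m₀).startCfg (s.mem C) q w)).head ≤
          max s.size w.length + C + 1 := by
  classical
  set l := max s.size w.length + C with hl
  have hfits := fitsFlag_iff A O O' w y t hs hC (g := g) (by omega)
  have hmode : nextMode s.mode t
      (fitsFlag A ((program A O O' C g).run w (s.mem C) y l))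
      (demandFlag A ((program A O O' C g).run w (s.mem C) y l))
      ((program A O O' C g).run w (s.mem C) y l).same = (s.next A O O' C g w y t).mode := by
    have hsame := run_same A O O' w y t hs hC (g := g) (by omega)
    have h1 : fitsFlag A ((program A O O' C g).run w (s.mem C) y l) = decide
        (∃ e, Fits A g (s.next A O O' C g w y t).cand l y e) := by
      rw [Bool.eq_iff_iff, hfits, decide_eq_true_eq]
    have h2 : ((program A O O' C g).run w (s.mem C) y l).same = decide
        (Spells (s.next A O O' C g w y t).test y) := by
      rw [Bool.eq_iff_iff, hsame, decide_eq_true_eq]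
    by_cases hfit : ∃ e, Fits A g (s.next A O O' C g w y t).cand l y e
    · have h3 : demandFlag A ((program A O O' C g).run w (s.mem C) y l) = decide
          (Demands A g (s.next A O O' C g w y t).cand (s.next A O O' C g w y t).test) := by
        rw [Bool.eq_iff_iff, demandFlag_iff A O O' w y t hs hC hg
          (hfit.imp fun _ h => h.1), decide_eq_true_eq]
      rw [h1, h2, h3]
      rfl
    -- Here the demand flag may be wrong, but it has no influence: a candidate that does not fit is
    -- recorded as bad or rejected anyway.
    · rw [h1, h2, decide_eq_false hfit]
      have h4 : (s.next A O O' C g w y t).mode = nextMode s.mode t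
        (decide (∃ e, Fits A g (s.next A O O' C g w y t).cand l y e))
        (decide (Demands A g (s.next A O O' C g w y t).cand (s.next A O O' C g w y t).test))
        (decide (Spells (s.next A O O' C g w y t).test y)) := rfl
      rw [h4, decide_eq_false hfit]
      simp [nextMode]
  have hhyp : ∀ i < l, (if fitsFlag A ((program A O O' C g).run w (s.mem C) y l) then
      ((s.next A O O' C g w y t).cand i).1 else s.hyp[i]?) =
      (s.next A O O' C g w y t).hyp[i]? := by
    intro i _
    have h4 : (s.next A O O' C g w y t).hyp =
      if h : ∃ e, Fits A g (s.next A O O' C g w y t).cand l y e then h.choose else s.hyp := rfl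
    by_cases hfit : ∃ e, Fits A g (s.next A O O' C g w y t).cand l y e
    · rw [if_pos (hfits.2 hfit), h4, dif_pos hfit]
      exact hfit.choose_spec.1 i
    · rw [if_neg (fun h => hfit (hfits.1 h)), h4, dif_neg hfit]
  refine (program A O O' C g).cycle_spec m₀ w (s.mem C) y t rest q l hq (by omega)
    (by simp [Conf.mem]; omega) (by omega) ?_ ?_ _ _ (by simp [Conf.mem, Conf.next, hl])
    (hs.next A O O' w y t).hyp ?_
  · intro i hi
    have := run_margin A O O' w y hs hC (g := g) i hi.le
    refine decide_eq_false ?_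
    omega
  · have := run_margin A O O' w y hs hC (g := g) l le_rfl
    refine decide_eq_true ?_
    omega
  · intro i hi
    have h1 := (run_mode_carry A O O' w y hs hC (g := g) l).1
    have hh := hhyp i hi
    rw [emitted_eq A O O' w y t hs hC i hi, translate_eq]
    dsimp only
    rw [h1, hmode, hh]
    refine ⟨?_, rfl⟩
    have hi' : i < (s.next A O O' C g w y t).size + C := hi
    simp only [Conf.mem, List.getElem?_map, List.getElem?_range hi', Option.map_some]
    rfl

end Cycle

end AutomaticLearner

namespace AutomaticLearner

variable {σ ι Q : Type}

/-! ### Rotation of the queue. -/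

section Records

variable (T : ℕ → List σ)

/-- The records in the queue before cycle `n`; the first datum is marked. -/
def records : ℕ → List (List σ × Bool)
  | 0 => []
  | n + 1 => (records n ++ [(T n, decide (n = 0))]).tail ++
      [(records n ++ [(T n, decide (n = 0))]).headD ([], false)]

/-- The record that is moved in cycle `n`. -/
def popped (n : ℕ) : List σ × Bool :=
  (records T n ++ [(T n, decide (n = 0))]).headD ([], false)

theorem records_append (n : ℕ) :
    records T n ++ [(T n, decide (n = 0))] =
      popped T n :: (records T n ++ [(T n, decide (n = 0))]).tail := by
  rw [popped]
  cases records T n <;> rfl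

theorem records_succ (n : ℕ) :
    records T (n + 1) = (records T n ++ [(T n, decide (n = 0))]).tail ++ [popped T n] := rfl

theorem records_perm (n : ℕ) :
    (records T n).Perm ((List.range n).map fun i => (T i, decide (i = 0))) := by
  induction n with
  | zero => exact List.Perm.refl _
  | succ n ih =>
    rw [records_succ, List.range_succ, List.map_append]
    refine List.perm_append_comm.trans ?_
    rw [List.singleton_append, ← records_append]
    exact ih.append_right _

theorem length_records (n : ℕ) : (records T n).length = n := by
  simpa using (records_perm T n).length_eq

theorem records_add (n s : ℕ) (hs : s ≤ n) :
    ∃ Z, records T (n + s) = (records T n).drop s ++ Z := by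
  induction s with
  | zero => exact ⟨[], by simp⟩
  | succ s ih =>
    obtain ⟨Z, hZ⟩ := ih (by omega)
    have hlt : s < (records T n).length := by rw [length_records]; omega
    rw [← Nat.add_assoc, records_succ, hZ, List.drop_eq_getElem_cons hlt]
    simp only [List.cons_append, List.tail_cons, List.append_assoc]
    exact ⟨_, rfl⟩

/-- The `n` records present before cycle `n` are moved in order during the next `n` cycles, while
everything appended in the meantime stays behind them. -/
theorem popped_add (n s : ℕ) (hs : s < n) : (records T n)[s]? = some (popped T (n + s)) := by
  obtain ⟨Z, hZ⟩ := records_add T n s hs.le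
  have hlt : s < (records T n).length := by rw [length_records]; omega
  rw [popped, hZ, List.drop_eq_getElem_cons hlt, List.getElem?_eq_getElem hlt]
  rfl

theorem popped_mem (n : ℕ) : ∃ i ≤ n, popped T n = (T i, decide (i = 0)) := by
  have h : popped T n ∈ (List.range (n + 1)).map fun i => (T i, decide (i = 0)) := by
    rw [← (records_perm T (n + 1)).mem_iff, records_succ]
    simp
  obtain ⟨i, hi, h⟩ := List.mem_map.1 h
  exact ⟨i, by simpa [Nat.lt_succ_iff] using hi, h.symm⟩

theorem exists_popped (n i : ℕ) (hi : i < n) :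
    ∃ s < n, (popped T (n + s)).1 = T i := by
  have h : (T i, decide (i = 0)) ∈ records T n := by
    rw [(records_perm T n).mem_iff]
    exact List.mem_map.2 ⟨i, by simpa using hi, rfl⟩
  obtain ⟨s, hs⟩ := List.mem_iff_getElem?.1 h
  have hlt : s < n := by
    rw [← length_records T n]
    exact (List.getElem?_eq_some_iff.1 hs).1
  rw [popped_add T n s hlt] at hs
  exact ⟨s, hlt, by rw [Option.some.inj hs]⟩

/-- After cycle `2 ^ r - 1` the marked record is the last of `2 ^ r`, so it takes exactly `2 ^ r`
more cycles until it is moved again. -/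
theorem popped_last (r : ℕ) : popped T (2 ^ r - 1) = (T 0, true) := by
  induction r with
  | zero => rfl
  | succ r ih =>
    have hpos : 0 < 2 ^ r := Nat.two_pow_pos r
    have h1 := popped_add T (2 ^ r) (2 ^ r - 1) (by omega)
    obtain ⟨k, hk⟩ : ∃ k, 2 ^ r = k + 1 := ⟨2 ^ r - 1, by omega⟩
    have h2 : 2 ^ (r + 1) - 1 = 2 ^ r + (2 ^ r - 1) := by rw [pow_succ]; omega
    rw [h2]
    rw [hk] at h1 ih ⊢
    rw [Nat.add_sub_cancel] at h1 ih ⊢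
    have h3 : (records T (k + 1))[k]? = some (popped T k) := by
      have hl : ((records T k ++ [(T k, decide (k = 0))]).tail).length = k := by
        simp [length_records]
      rw [records_succ, List.getElem?_append_right hl.le, hl]
      simp
    rw [h3, ih] at h1
    exact (Option.some.inj h1).symm

/-- The mark belongs to the occurrence, not to the word: only the record of index `0` has it, even
if the same datum appears again. -/
theorem popped_flag (r s : ℕ) (hs : s + 1 < 2 ^ r) : (popped T (2 ^ r + s)).2 = false := by
  obtain ⟨k, hk⟩ : ∃ k, 2 ^ r = k + 1 := ⟨2 ^ r - 1, by omega⟩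
  have h0 := popped_last T r
  have h1 := popped_add T (2 ^ r) s (by omega)
  rw [hk] at h0 h1 hs ⊢
  rw [Nat.add_sub_cancel] at h0
  have hp := records_perm T (k + 1)
  rw [records_succ, h0, List.range_succ_eq_map, List.map_cons] at hp
  have hp' := (List.perm_append_comm.trans hp)
  rw [List.singleton_append] at hp'
  have hp'' := List.Perm.cons_inv hp'
  have hl : ((records T k ++ [(T k, decide (k = 0))]).tail).length = k := by
    simp [length_records]
  rw [records_succ, List.getElem?_append_left (by rw [hl]; omega)] at h1
  have hm := hp''.mem_iff.1 (List.mem_of_getElem? h1)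
  simp only [List.map_map, List.mem_map, Function.comp_apply, List.mem_range] at hm
  obtain ⟨i, -, hi⟩ := hm
  rw [← hi]
  simp

/-- The content of the queue that holds the given records. -/
def encode (R : List (List σ × Bool)) : List (σ ⊕ Bool) :=
  R.flatMap fun r => r.1.map .inl ++ [.inr r.2]

/-- Every record contributes at least its terminator, so the queue is empty only before cycle `0`,
and the machine's test for emptiness marks precisely the first datum. -/
theorem encode_push (n : ℕ) :
    encode (records T n) ++ (T n).map .inl ++ [.inr (encode (records T n)).head?.isNone] =
      (popped T n).1.map .inl ++ .inr (popped T n).2 ::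
        encode (records T n ++ [(T n, decide (n = 0))]).tail := by
  have h1 : (encode (records T n)).head?.isNone = decide (n = 0) := by
    have hl := length_records T n
    cases h : records T n with
    | nil =>
      rw [h] at hl
      simp only [List.length_nil] at hl
      subst hl
      rfl
    | cons a R =>
      rw [h] at hl
      have hn : n ≠ 0 := by
        rintro rfl
        simp at hl
      simp [encode, hn]
  have h2 := congrArg encode (records_append T n)
  rw [h1]
  simpa [encode] using h2

theorem encode_succ (n : ℕ) :
    encode (records T (n + 1)) = encode (records T n ++ [(T n, decide (n = 0))]).tail ++
      (popped T n).1.map .inl ++ [.inr (popped T n).2] := by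
  rw [records_succ]
  simp [encode]

end Records

/-! ### The run of the learner and its resource bounds. -/

section Run

variable (A : DFA (Option ι × Option σ) Q) (O : Odometer (Option ι × Bool) (none, false))
  (O' : Odometer (Option σ × Bool) (none, false)) (C g : ℕ) (e₀ : List ι) (T : ℕ → List σ)

/-- The initial content of the long term memory. -/
def initial : Conf σ ι :=
  ⟨0, fun _ => (none, false), fun _ => (none, false), e₀, ⟨false, false, false, false⟩⟩

/-- The content of the long term memory before cycle `n`. -/
noncomputable def conf : ℕ → Conf σ ι
  | 0 => initial e₀
  | n + 1 => (conf n).next A O O' C g (T n) (popped T n).1 (popped T n).2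

/-- The learner. -/
noncomputable def learner [Finite σ] [Finite ι] [Finite Q] : QueueLearner σ ι :=
  (program A O O' C g).toLearner ((initial e₀).mem C)

theorem conf_size (n : ℕ) :
    (conf A O O' C g e₀ T n).size = (Finset.range n).sup fun i => (T i).length := by
  induction n with
  | zero => rfl
  | succ n ih =>
    rw [Finset.range_add_one, Finset.sup_insert, ← ih, max_comm]
    rfl

theorem conf_size_succ (n : ℕ) :
    (conf A O O' C g e₀ T (n + 1)).size = QueueLearner.maxLen T n :=
  conf_size A O O' C g e₀ T (n + 1)

theorem length_le_size {i n : ℕ} (hi : i < n) :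
    (T i).length ≤ (conf A O O' C g e₀ T n).size := by
  rw [conf_size]
  exact Finset.le_sup (f := fun i => (T i).length) (Finset.mem_range.2 hi)

theorem conf_size_mono : Monotone fun n => (conf A O O' C g e₀ T n).size := by
  intro m n h
  simp only [conf_size]
  exact Finset.sup_mono (Finset.range_mono h)

variable {C g e₀}

theorem conf_wellFormed (he₀ : e₀.length ≤ C) (n : ℕ) :
    (conf A O O' C g e₀ T n).WellFormed C := by
  induction n with
  | zero => exact ⟨fun _ _ => rfl, fun _ _ => rfl, by simpa [conf, initial] using he₀⟩
  | succ n ih => exact ih.next ..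

variable [Finite σ] [Finite ι] [Finite Q]

theorem learner_cycle (hC : 0 < C) (hg : 0 < g) (he₀ : e₀.length ≤ C) (n : ℕ) :
    (learner A O O' C g e₀).CycleWithin
        (2 * (T n).length + 2 * ((conf A O O' C g e₀ T (n + 1)).size + C) + 5)
        ((conf A O O' C g e₀ T n).mem C) (encode (records T n)) (T n)
        ((conf A O O' C g e₀ T (n + 1)).mem C) (encode (records T (n + 1)))
        (conf A O O' C g e₀ T (n + 1)).hyp ∧
      ∀ s, ((learner A O O' C g e₀).step^[s] ((learner A O O' C g e₀).startCfg
        ((conf A O O' C g e₀ T n).mem C) (encode (records T n)) (T n))).head ≤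
          (conf A O O' C g e₀ T (n + 1)).size + C + 1 := by
  have hy : (popped T n).1.length ≤ (conf A O O' C g e₀ T (n + 1)).size := by
    obtain ⟨i, hi, h⟩ := popped_mem T n
    rw [h]
    exact length_le_size A O O' C g e₀ T (Nat.lt_succ_of_le hi)
  rw [encode_succ]
  exact program_cycle A O O' (T n) (popped T n).1 (popped T n).2 ((initial e₀).mem C)
    (conf_wellFormed A O O' T he₀ n) hC hg _ _ (encode_push T n) hy

theorem learner_isRun (hC : 0 < C) (hg : 0 < g) (he₀ : e₀.length ≤ C) :
    (learner A O O' C g e₀).IsRun T (fun n => (conf A O O' C g e₀ T n).mem C)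
      (fun n => encode (records T n)) (fun n => (conf A O O' C g e₀ T (n + 1)).hyp) :=
  ⟨rfl, rfl, fun n => ⟨_, (learner_cycle A O O' T hC hg he₀ n).1⟩⟩

theorem learner_isLinearTime (hC : 0 < C) (hg : 0 < g) (he₀ : e₀.length ≤ C) :
    (learner A O O' C g e₀).IsLinearTime := by
  -- With `M` the length of the tape at the start, the datum has length at most `M` and the sweep at
  -- most `M + C`, which gives at most `4 * M + 2 * C + 5` steps.
  refine ⟨2 * C + 9, fun T => ⟨_, _, _, learner_isRun A O O' T hC hg he₀, fun n => ?_⟩⟩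
  obtain ⟨h1, h2⟩ := learner_cycle A O O' T hC hg he₀ n
  have hw := (conf_wellFormed A O O' T he₀ (g := g) (n + 1)).hyp
  have hm : ∀ n, ((conf A O O' C g e₀ T n).mem C).length =
      (conf A O O' C g e₀ T n).size + C := by
    intro n
    simp [Conf.mem]
  have hs : (conf A O O' C g e₀ T (n + 1)).size =
    max (conf A O O' C g e₀ T n).size (T n).length := rfl
  have hmax := conf_size_succ A O O' C g e₀ T n
  refine ⟨⟨_, ?_, h1⟩, ?_, ?_, fun s => (h2 s).trans ?_⟩
  · have hconv : (conv (T n) ((conf A O O' C g e₀ T n).mem C)).length =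
        max (T n).length ((conf A O O' C g e₀ T n).size + C) := by rw [conv_length, hm]
    refine le_trans ?_ (Nat.mul_le_mul_left _ (Nat.succ_le_succ hconv.ge))
    have h3 : 4 * max (T n).length ((conf A O O' C g e₀ T n).size + C) ≤
        (2 * C + 8) * max (T n).length ((conf A O O' C g e₀ T n).size + C) :=
      Nat.mul_le_mul_right _ (by omega)
    have h4 : ∀ M, (2 * C + 9) * (M + 1) = (2 * C + 8) * M + M + (2 * C + 9) := fun M => by ring
    rw [Nat.succ_eq_add_one, h4]
    omega
  · refine (hm _).trans_le ?_
    omega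
  · omega
  · omega

end Run

/-! ### Rounds of `2 ^ r` cycles. -/

section Rounds

variable (A : DFA (Option ι × Option σ) Q) (O : Odometer (Option ι × Bool) (none, false))
  (O' : Odometer (Option σ × Bool) (none, false)) (C g : ℕ) (e₀ : List ι) (T : ℕ → List σ)

local notation "cf" => conf A O O' C g e₀ T

open Classical in
theorem conf_mode_succ (n : ℕ) :
    (cf (n + 1)).mode = nextMode (cf n).mode (popped T n).2
      (decide (∃ e, Fits A g (cf (n + 1)).cand ((cf (n + 1)).size + C) (popped T n).1 e))
      (decide (Demands A g (cf (n + 1)).cand (cf (n + 1)).test))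
      (decide (Spells (cf (n + 1)).test (popped T n).1)) := rfl

theorem conf_cand_succ (n : ℕ) :
    (cf (n + 1)).cand = O.bump (cf n).mode.rej ((cf (n + 1)).size + C) (cf n).cand := rfl

theorem conf_test_succ (n : ℕ) :
    (cf (n + 1)).test = O'.bump (cf n).mode.adv ((cf (n + 1)).size + C) (cf n).test := rfl

/-- The marked record moved in cycle `2 ^ r - 1` resets both flags and orders the increments, which
are carried out in cycle `2 ^ r`. Hence the round's counters are those after that cycle, and
unmarked records only accumulate flags. -/
theorem round_invariant (r : ℕ) : ∀ s < 2 ^ r,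
    ((cf (2 ^ r + s)).mode.found = true ↔
      ∃ j < s, Spells (cf (2 ^ r + 1)).test (popped T (2 ^ r + j)).1) ∧
    ((cf (2 ^ r + s)).mode.bad = true ↔ ∃ j < s, ¬ ∃ e, Fits A g (cf (2 ^ r + 1)).cand
      ((cf (2 ^ r + j + 1)).size + C) (popped T (2 ^ r + j)).1 e) ∧
    (cf (2 ^ r + s + 1)).cand = (cf (2 ^ r + 1)).cand ∧
    (cf (2 ^ r + s + 1)).test = (cf (2 ^ r + 1)).test := by
  intro s
  induction s with
  | zero =>
    intro _
    obtain ⟨k, hk⟩ : ∃ k, 2 ^ r = k + 1 := ⟨2 ^ r - 1, by have := Nat.two_pow_pos r; omega⟩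
    have h := popped_last T r
    rw [hk, Nat.add_sub_cancel] at h
    have hmode := conf_mode_succ A O O' C g e₀ T k
    rw [h] at hmode
    simp [hk, hmode, nextMode]
  | succ s ih =>
    intro hs
    obtain ⟨h1, h2, h3, h4⟩ := ih (by omega)
    have hmode := conf_mode_succ A O O' C g e₀ T (2 ^ r + s)
    rw [popped_flag T r s hs, nextMode, if_neg Bool.false_ne_true, h3, h4] at hmode
    have hc := conf_cand_succ A O O' C g e₀ T (2 ^ r + s + 1)
    have ht := conf_test_succ A O O' C g e₀ T (2 ^ r + s + 1)
    rw [hmode, O.bump_false, h3] at hc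
    rw [hmode, O'.bump_false, h4] at ht
    rw [← Nat.add_assoc, hmode]
    refine ⟨?_, ?_, hc, ht⟩
    · simp only [Bool.or_eq_true, h1, decide_eq_true_eq, Nat.lt_succ_iff_lt_or_eq, or_and_right,
        exists_or, exists_eq_left]
    · simp only [Bool.or_eq_true, h2, Bool.not_eq_true', decide_eq_false_iff_not,
        Nat.lt_succ_iff_lt_or_eq, or_and_right, exists_or, exists_eq_left]

/-- In round `r`, consisting of the cycles from `2 ^ r` on up to `2 ^ (r + 1) - 1`, the candidate
and the test word do not change. -/
theorem round_const (r s : ℕ) (hs : s < 2 ^ r) :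
    (cf (2 ^ r + s + 1)).cand = (cf (2 ^ (r + 1))).cand ∧
      (cf (2 ^ r + s + 1)).test = (cf (2 ^ (r + 1))).test := by
  have hpos := Nat.two_pow_pos r
  obtain ⟨-, -, h3, h4⟩ := round_invariant A O O' C g e₀ T r s hs
  obtain ⟨-, -, h5, h6⟩ := round_invariant A O O' C g e₀ T r (2 ^ r - 1) (by omega)
  rw [show 2 ^ r + (2 ^ r - 1) + 1 = 2 ^ (r + 1) by rw [pow_succ]; omega] at h5 h6
  exact ⟨h3.trans h5.symm, h4.trans h6.symm⟩

theorem round_adv (r : ℕ) : (cf (2 ^ r)).mode.adv = true := by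
  obtain ⟨k, hk⟩ : ∃ k, 2 ^ r = k + 1 := ⟨2 ^ r - 1, by have := Nat.two_pow_pos r; omega⟩
  have h := popped_last T r
  rw [hk, Nat.add_sub_cancel] at h
  rw [hk, conf_mode_succ, h]
  simp [nextMode]

/-- At the end of a round, the candidate is kept if it was consistent with all records and the word
demanded, if any, was found among them. -/
theorem round_rej (r : ℕ) :
    (cf (2 ^ (r + 1))).mode.rej = false ↔
      (∀ s < 2 ^ r, ∃ e, Fits A g (cf (2 ^ (r + 1))).cand ((cf (2 ^ r + s + 1)).size + C)
        (popped T (2 ^ r + s)).1 e) ∧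
      (Demands A g (cf (2 ^ (r + 1))).cand (cf (2 ^ (r + 1))).test →
        ∃ s < 2 ^ r, Spells (cf (2 ^ (r + 1))).test (popped T (2 ^ r + s)).1) := by
  have hpos := Nat.two_pow_pos r
  obtain ⟨h1, h2, h3, h4⟩ := round_invariant A O O' C g e₀ T r (2 ^ r - 1) (by omega)
  have hsucc : 2 ^ r + (2 ^ r - 1) + 1 = 2 ^ (r + 1) := by rw [pow_succ]; omega
  have hmode := conf_mode_succ A O O' C g e₀ T (2 ^ r + (2 ^ r - 1))
  have hlast := popped_last T (r + 1)
  rw [show 2 ^ (r + 1) - 1 = 2 ^ r + (2 ^ r - 1) by omega] at hlast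
  have hall : ∀ p : ℕ → Prop, (∀ s < 2 ^ r, p s) ↔ (∀ s < 2 ^ r - 1, p s) ∧ p (2 ^ r - 1) := by
    intro p
    refine ⟨fun h => ⟨fun s hs => h s (by omega), h _ (by omega)⟩, fun h s hs => ?_⟩
    by_cases hs' : s < 2 ^ r - 1
    · exact h.1 s hs'
    · rw [show s = 2 ^ r - 1 by omega]; exact h.2
  have hex : ∀ p : ℕ → Prop, (∃ s < 2 ^ r, p s) ↔ (∃ s < 2 ^ r - 1, p s) ∨ p (2 ^ r - 1) := by
    intro p
    have := hall (fun s => ¬ p s)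
    by_contra hcon
    push Not at hcon
    grind
  have hl2 : (popped T (2 ^ r + (2 ^ r - 1))).2 = true := by rw [hlast]
  rw [hl2, nextMode, if_pos rfl] at hmode
  rw [hsucc] at hmode h3 h4
  rw [← h3] at h2
  rw [← h4] at h1
  rw [hall, hex, hsucc, hmode]
  rw [← h1]
  have h2' : (cf (2 ^ r + (2 ^ r - 1))).mode.bad = false ↔ ∀ j < 2 ^ r - 1, ∃ e, Fits A g
      (cf (2 ^ (r + 1))).cand ((cf (2 ^ r + j + 1)).size + C) (popped T (2 ^ r + j)).1 e := by
    rw [← Bool.not_eq_true, h2]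
    push Not
    rfl
  rw [← h2']
  simp only [Bool.or_eq_false_iff, Bool.not_eq_false', decide_eq_true_eq, Bool.and_eq_false_iff,
    decide_eq_false_iff_not, Bool.or_eq_true]
  tauto

theorem round_cand_succ (r : ℕ) :
    (cf (2 ^ (r + 1 + 1))).cand = O.bump (cf (2 ^ (r + 1))).mode.rej
      ((cf (2 ^ (r + 1) + 1)).size + C) (cf (2 ^ (r + 1))).cand :=
  (round_const A O O' C g e₀ T (r + 1) 0 (Nat.two_pow_pos _)).1.symm

theorem round_test_succ (r : ℕ) :
    (cf (2 ^ (r + 1 + 1))).test = O'.bump true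
      ((cf (2 ^ (r + 1) + 1)).size + C) (cf (2 ^ (r + 1))).test := by
  rw [← round_adv A O O' C g e₀ T (r + 1)]
  exact (round_const A O O' C g e₀ T (r + 1) 0 (Nat.two_pow_pos _)).2.symm

end Rounds

end AutomaticLearner

namespace AutomaticLearner

variable {σ ι Q : Type}

/-! ### Convergence to a correct hypothesis. -/

section Correctness

variable {A : DFA (Option ι × Option σ) Q} (O : Odometer (Option ι × Bool) (none, false))
  (O' : Odometer (Option σ × Bool) (none, false)) {C g : ℕ} {e₀ : List ι} (T : ℕ → List σ)
  {I : Language ι} {L : List ι → Language σ}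

local notation "cf" => conf A O O' C g e₀ T

/-- The hypothesis is replaced only by a candidate that the automaton accepted together with some
record, and such a candidate is an index. -/
theorem conf_hyp_mem (hA : ∀ e x, A.eval (conv e x) ∈ A.accept ↔ e ∈ I ∧ x ∈ L e) (he₀ : e₀ ∈ I)
    (n : ℕ) : (cf n).hyp ∈ I := by
  induction n with
  | zero => exact he₀
  | succ n ih =>
    rw [conf, Conf.next]
    dsimp only
    split
    · next h => exact ((hA _ _).1 h.choose_spec.2.2).1
    · exact ih

theorem conf_hyp_eq (n : ℕ) {e : List ι} (he : Spells (cf (n + 1)).cand e)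
    (h : ∃ e, Fits A g (cf (n + 1)).cand ((cf (n + 1)).size + C) (popped T n).1 e) :
    (cf (n + 1)).hyp = e := by
  have h1 : (cf (n + 1)).hyp = h.choose := dif_pos h
  rw [h1]
  exact h.choose_spec.1.unique he

/-- A correct candidate is kept, once all words of its tell-tale set have been seen. -/
theorem rej_eq_false (hA : ∀ e x, A.eval (conv e x) ∈ A.accept ↔ e ∈ I ∧ x ∈ L e)
    {e : List ι} (he : e ∈ I) (hT : IsText T (L e)) {N r : ℕ}
    (hsize : e.length + g ≤ (cf N).size + C)
    (hseen : ∀ x ∈ L e, x.length ≤ e.length + g → ∃ i < N, T i = x) (hr : N ≤ 2 ^ r)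
    (hsp : Spells (cf (2 ^ (r + 1))).cand e) : (cf (2 ^ (r + 1))).mode.rej = false := by
  rw [round_rej]
  constructor
  · intro s _
    refine ⟨e, hsp, hsize.trans (Nat.add_le_add_right
      (conf_size_mono A O O' C g e₀ T (by omega)) _), (hA _ _).2 ⟨he, ?_⟩⟩
    obtain ⟨i, -, hi⟩ := popped_mem T (2 ^ r + s)
    rw [hi]
    exact (hT _).1 ⟨i, rfl⟩
  · rintro ⟨e', x, he', hx, hlen, hacc⟩
    obtain rfl := hsp.unique he'
    obtain ⟨i, hi, rfl⟩ := hseen x ((hA _ _).1 hacc).2 hlen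
    obtain ⟨s, hs, h⟩ := exists_popped T (2 ^ r) i (hi.trans_le hr)
    exact ⟨s, hs, by rwa [h]⟩

/-- A candidate that is never rejected is correct. -/
theorem eq_of_forall_rej_eq_false
    (hA : ∀ e x, A.eval (conv e x) ∈ A.accept ↔ e ∈ I ∧ x ∈ L e)
    (htell : ∀ e ∈ I, ∀ d ∈ I, (∀ x ∈ L e, x.length ≤ e.length + g → x ∈ L d) →
      (∀ x ∈ L d, x ∈ L e) → L d = L e) (he₀ : e₀.length ≤ C)
    {e : List ι} (he : e ∈ I) (hT : IsText T (L e)) {r₀ : ℕ}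
    (hrej : ∀ r, r₀ ≤ r → (cf (2 ^ (r + 1))).mode.rej = false) :
    ∃ d, L d = L e ∧ ∀ n, 2 ^ r₀ ≤ n → (cf (n + 1)).hyp = d := by
  have hconst : ∀ r, r₀ ≤ r → (cf (2 ^ (r + 1))).cand = (cf (2 ^ (r₀ + 1))).cand := by
    intro r hr
    induction r, hr using Nat.le_induction with
    | base => rfl
    | succ r hr ih => rw [round_cand_succ, hrej r hr, O.bump_false, ih]
  have hfits : ∀ r, r₀ ≤ r → ∀ s < 2 ^ r, ∃ d, Fits A g (cf (2 ^ (r₀ + 1))).cand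
      ((cf (2 ^ r + s + 1)).size + C) (popped T (2 ^ r + s)).1 d := by
    intro r hr
    have := ((round_rej A O O' C g e₀ T r).1 (hrej r hr)).1
    rwa [hconst r hr] at this
  obtain ⟨d, hd, hdl, hda⟩ := hfits r₀ le_rfl 0 (Nat.two_pow_pos _)
  have hdI : d ∈ I := ((hA _ _).1 hda).1
  refine ⟨d, ?_, ?_⟩
  · refine (htell d hdI e he ?_ ?_).symm
    · intro x hx hxl
      -- The test word advances in every round, and `Fits` leaves room for words of length `|d| +
      -- g`. So the tell-tale word `x` is tested in some round; as `d` survives that round, `x` is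
      -- among the records and hence in `L e`.
      have hvisit := O'.exists_spells (E := fun t => (cf (2 ^ (r₀ + t + 1))).test)
        (c := fun _ => true) (l := fun t => (cf (2 ^ (r₀ + t) + 1)).size + C) ?_ ?_
        (fun t => round_test_succ A O O' C g e₀ T (r₀ + t)) (fun t => ⟨t, le_rfl, rfl⟩) x
        (hxl.trans hdl)
      · obtain ⟨t, ht⟩ := hvisit
        obtain ⟨s, -, hs⟩ := ((round_rej A O O' C g e₀ T (r₀ + t)).1 (hrej _ (by omega))).2
          ⟨d, x, by rwa [hconst _ (by omega)], ht, hxl, (hA _ _).2 ⟨hdI, hx⟩⟩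
        obtain ⟨i, -, hi⟩ := popped_mem T (2 ^ (r₀ + t) + s)
        rw [hi] at hs
        rw [ht.unique hs]
        exact (hT _).1 ⟨i, rfl⟩
      · intro t i hi
        have := (round_const A O O' C g e₀ T (r₀ + t) 0 (Nat.two_pow_pos _)).2
        rw [← this]
        exact (conf_wellFormed A O O' T he₀ _).test i hi
      · intro t t' htt
        refine Nat.add_le_add_right (conf_size_mono A O O' C g e₀ T ?_) _
        exact Nat.succ_le_succ (Nat.pow_le_pow_right (by norm_num) (by omega))
    · intro x hx
      obtain ⟨i, rfl⟩ := (hT x).2 hx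
      -- Round `r₀ + i` is late enough for the datum `T i` to be among the records reread.
      obtain ⟨s, hs, h⟩ := exists_popped T (2 ^ (r₀ + i)) i
        ((Nat.lt_two_pow_self).trans_le (Nat.pow_le_pow_right (by norm_num) (by omega)))
      obtain ⟨d', hd', -, hacc⟩ := hfits (r₀ + i) (by omega) s hs
      obtain rfl := hd.unique hd'
      rw [h] at hacc
      exact ((hA _ _).1 hacc).2
  · intro n hn
    have hpos : 0 < 2 ^ r₀ := Nat.two_pow_pos _
    -- Cycle `n` belongs to round `Nat.log 2 n`; in each of its cycles the candidate fits and
    -- becomes the hypothesis.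
    have hr : r₀ ≤ Nat.log 2 n := Nat.le_log_of_pow_le (by norm_num) hn
    have h1 : 2 ^ Nat.log 2 n ≤ n := Nat.pow_log_le_self 2 (by omega)
    have h2 : n < 2 ^ (Nat.log 2 n + 1) := Nat.lt_pow_succ_log_self (by norm_num) n
    obtain ⟨s, hs⟩ := Nat.exists_eq_add_of_le h1
    rw [pow_succ] at h2
    have hs' : s < 2 ^ Nat.log 2 n := by omega
    have hf := hfits _ hr s hs'
    rw [← hconst _ hr, ← (round_const A O O' C g e₀ T _ s hs').1, ← hs] at hf
    refine conf_hyp_eq O O' T n ?_ hf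
    have h3 := (round_const A O O' C g e₀ T _ s hs').1
    rw [hconst _ hr, ← hs] at h3
    rwa [h3]

/-- From every text for a language of the family, the hypotheses converge to an index of it. -/
theorem conf_identifies [Finite σ]
    (hA : ∀ e x, A.eval (conv e x) ∈ A.accept ↔ e ∈ I ∧ x ∈ L e)
    (htell : ∀ e ∈ I, ∀ d ∈ I, (∀ x ∈ L e, x.length ≤ e.length + g → x ∈ L d) →
      (∀ x ∈ L d, x ∈ L e) → L d = L e)
    (hindex : ∀ e ∈ I, ∀ m : ℕ, (∀ x ∈ L e, x.length ≤ m) →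
      ∃ e' ∈ I, L e' = L e ∧ e'.length + g ≤ m + C)
    (he₀ : e₀.length ≤ C) (he₀I : e₀ ∈ I) {e : List ι} (he : e ∈ I) (hT : IsText T (L e)) :
    Identifies I L e (fun n => (cf (n + 1)).hyp) := by
  refine ⟨fun n => conf_hyp_mem O O' T hA he₀I _, ?_⟩
  -- If the data are too short for `e` forever, their lengths are bounded, the maximum is attained,
  -- and `hindex` supplies a shorter index that fits with the margin `g`.
  have hshort : ∃ e' ∈ I, L e' = L e ∧ ∃ N, e'.length + g ≤ (cf N).size + C := by
    by_cases h : ∃ N, e.length + g ≤ (cf N).size + C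
    · exact ⟨e, he, rfl, h⟩
    · push Not at h
      have hbdd : BddAbove (Set.range fun N => (cf N).size) := by
        refine ⟨e.length + g, ?_⟩
        rintro _ ⟨N, rfl⟩
        have := h N
        dsimp only
        omega
      obtain ⟨N, hN⟩ := Nat.sSup_mem (Set.range_nonempty _) hbdd
      obtain ⟨e', h1, h2, h3⟩ := hindex e he (cf N).size (by
        intro x hx
        obtain ⟨i, rfl⟩ := (hT x).2 hx
        refine (length_le_size A O O' C g e₀ T (Nat.lt_succ_self i)).trans ?_
        dsimp only at hN
        rw [hN]
        exact le_csSup hbdd ⟨i + 1, rfl⟩)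
      exact ⟨e', h1, h2, N, h3⟩
  obtain ⟨e', he', hL, N₁, hN₁⟩ := hshort
  rw [← hL] at hT ⊢
  have hseen : ∃ N₂, ∀ x ∈ L e', x.length ≤ e'.length + g → ∃ i < N₂, T i = x := by
    have hfin : {x : List σ | x.length ≤ e'.length + g}.Finite := List.finite_length_le σ _
    have hidx : ∀ x : List σ, ∃ i, x ∈ L e' → T i = x := by
      intro x
      by_cases hx : x ∈ L e'
      · obtain ⟨i, hi⟩ := (hT x).2 hx
        exact ⟨i, fun _ => hi⟩
      · exact ⟨0, fun h => absurd h hx⟩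
    choose f hf using hidx
    obtain ⟨b, hb⟩ := (hfin.image f).bddAbove
    exact ⟨b + 1, fun x hx hxl =>
      ⟨f x, Nat.lt_succ_of_le (hb ⟨x, hxl, rfl⟩), hf x hx⟩⟩
  obtain ⟨N₂, hN₂⟩ := hseen
  have hsize : e'.length + g ≤ (cf (max N₁ N₂)).size + C :=
    hN₁.trans (Nat.add_le_add_right (conf_size_mono A O O' C g e₀ T (le_max_left _ _)) _)
  have hseen : ∀ x ∈ L e', x.length ≤ e'.length + g → ∃ i < max N₁ N₂, T i = x := by
    intro x hx hxl
    obtain ⟨i, hi, h⟩ := hN₂ x hx hxl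
    exact ⟨i, hi.trans_le (le_max_right _ _), h⟩
  generalize max N₁ N₂ = N at hsize hseen
  have hNpow : ∀ r, N ≤ r → N ≤ 2 ^ r := fun r hr => hr.trans Nat.lt_two_pow_self.le
  have hstable : ∃ r₀, ∀ r, r₀ ≤ r → (cf (2 ^ (r + 1))).mode.rej = false := by
    by_contra! hcon
    -- Infinitely many rejections would drive the candidate counter to `e'` after round `N`, from
    -- where on `e'` is kept. The limit need not be `e'`: the counter may stop earlier at another
    -- candidate, which is then correct too.
    have hvisit := O.exists_spells (E := fun t => (cf (2 ^ (N + t + 1))).cand)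
      (c := fun t => (cf (2 ^ (N + t + 1))).mode.rej)
      (l := fun t => (cf (2 ^ (N + t) + 1)).size + C) ?_ ?_
      (fun t => round_cand_succ A O O' C g e₀ T (N + t)) ?_ e' ?_
    · obtain ⟨t, ht⟩ := hvisit
      have hkeep : ∀ r, N + t ≤ r → Spells (cf (2 ^ (r + 1))).cand e' := by
        intro r hr
        induction r, hr using Nat.le_induction with
        | base => exact ht
        | succ r hr ih =>
          rw [round_cand_succ, rej_eq_false O O' T hA he' hT hsize hseen (hNpow r (by omega)) ih,
            O.bump_false]
          exact ih
      obtain ⟨r, hr, hne⟩ := hcon (N + t)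
      exact hne (rej_eq_false O O' T hA he' hT hsize hseen (hNpow r (by omega)) (hkeep r hr))
    · intro t i hi
      have := (round_const A O O' C g e₀ T (N + t) 0 (Nat.two_pow_pos _)).1
      rw [← this]
      exact (conf_wellFormed A O O' T he₀ _).cand i hi
    · intro t t' htt
      refine Nat.add_le_add_right (conf_size_mono A O O' C g e₀ T ?_) _
      exact Nat.succ_le_succ (Nat.pow_le_pow_right (by norm_num) (by omega))
    · intro t
      obtain ⟨r, hr, hne⟩ := hcon (N + t)
      refine ⟨r - N, by omega, ?_⟩
      rw [Nat.add_sub_cancel' (by omega)]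
      simpa using hne
    · refine (Nat.le_add_right _ g).trans (hsize.trans (Nat.add_le_add_right
        (conf_size_mono A O O' C g e₀ T ?_) _))
      have := hNpow N le_rfl
      simp only [Nat.add_zero]
      omega
  obtain ⟨r₀, hr₀⟩ := hstable
  obtain ⟨d, hd, hconv⟩ := eq_of_forall_rej_eq_false O O' T hA htell he₀ he' hT hr₀
  exact ⟨2 ^ r₀, (congrArg L (hconv _ le_rfl)).trans hd, fun k hk =>
    (hconv _ hk).trans (hconv _ le_rfl).symm⟩

end Correctness

end AutomaticLearner

/-! ### Assembling the learner. -/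

theorem theorem3p7 {σ ι : Type} [Finite σ] [Finite ι] [Primcodable σ] [Primcodable ι]
    (I : Language ι) (L : List ι → Language σ)
    (hauto : IsAutomaticFamily I L)
    (hne : ∀ e ∈ I, ∃ x, x ∈ L e)
    (hlearn : Learnable I L) :
    ∃ N : QueueLearner σ ι, N.IsLinearTime ∧ N.Learns I L := by
  obtain ⟨⟨P, _, B, hB⟩, ⟨Q, _, A, hA⟩⟩ := hauto
  obtain ⟨m₀, M, -, hM⟩ := hlearn
  have hA' : ∀ e x, A.eval (conv e x) ∈ A.accept ↔ e ∈ I ∧ x ∈ L e := by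
    intro e x
    rw [← DFA.mem_accepts, hA]
    constructor
    · rintro ⟨e', he', x', hx', h⟩
      obtain ⟨rfl, rfl⟩ := conv_injective h
      exact ⟨he', hx'⟩
    · rintro ⟨he, hx⟩
      exact ⟨e, he, x, hx, rfl⟩
  have hA'' : ∀ e ∈ I, ∀ x, A.eval (conv e x) ∈ A.accept ↔ x ∈ L e := fun e he x =>
    (hA' e x).trans (and_iff_right he)
  have hB' : ∀ e, B.eval e ∈ B.accept ↔ e ∈ I := by
    intro e
    rw [← DFA.mem_accepts, hB]
  obtain ⟨c₁, hc₁⟩ := exists_telltale_bound A B hA'' hB' fun e he =>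
    exists_telltale m₀ M hne hM he
  obtain ⟨c₀, hc₀⟩ := exists_index_bound A B hA'' hB'
  obtain ⟨O⟩ := Odometer.nonempty (Option ι × Bool) (none, false)
  obtain ⟨O'⟩ := Odometer.nonempty (Option σ × Bool) (none, false)
  -- The initial hypothesis must be an index, unless the family is empty; even then the machine has
  -- to run in linear time.
  obtain ⟨e₀, he₀⟩ : ∃ e₀ : List ι, (∃ e, e ∈ I) → e₀ ∈ I := by
    by_cases h : ∃ e, e ∈ I
    · exact ⟨h.choose, fun _ => h.choose_spec⟩
    · exact ⟨[], fun h' => absurd h' h⟩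
  -- The slack `C` accommodates an index of length `m + c₀` together with the gap `g = c₁ + 1`, and
  -- the initial hypothesis. The gap is `c₁ + 1` only to be positive.
  have hC : 0 < c₀ + (c₁ + 1) + e₀.length := by omega
  have hg : 0 < c₁ + 1 := by omega
  have hlen : e₀.length ≤ c₀ + (c₁ + 1) + e₀.length := by omega
  refine ⟨AutomaticLearner.learner A O O' (c₀ + (c₁ + 1) + e₀.length) (c₁ + 1) e₀,
    AutomaticLearner.learner_isLinearTime A O O' hC hg hlen, fun e he T hT =>
      ⟨_, _, _, AutomaticLearner.learner_isRun A O O' T hC hg hlen, ?_⟩⟩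
  refine AutomaticLearner.conf_identifies O O' T hA' ?_ ?_ hlen (he₀ ⟨e, he⟩) he hT
  · intro e he d hd h1 h2
    exact hc₁ e he d hd (fun x hx hxl => h1 x hx (by omega)) h2
  · intro e he m hm
    obtain ⟨e', h1, h2, h3⟩ := hc₀ e he m hm
    exact ⟨e', h1, h2, by omega⟩
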